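/- Let $d\ge 1$ and $n\ge 1$ be integers and $q\in\mathbb{C}\setminus\{0\}$. Let $\mathcal F_{d,n}\cong(\mathbb Z/d\mathbb Z)^n\rtimes B_n$ be the modular framed braid group, generated by the braid generators $\sigma_1,\dots,\sigma_{n-1}$ and commuting framing generators $t_1,\dots,t_n$ with $t_j^d=1$ and $t_j\sigma_i=\sigma_i t_{s_i(j)}$, where $s_i=(i,i+1)$. The Yokonuma--Hecke algebra $Y_{d,n}(q)$ is the quotient of $\mathbb{C}\mathcal F_{d,n}$ by the relations $g_i^2=1+(q-q^{-1})e_ig_i$, where $g_i$ is the class of $\sigma_i$ and $e_i=\frac1d\sum_{s=1}^{d}t_i^st_{i+1}^{-s}$. Let $\mathrm{tr}_d:\bigcup_{n\ge 0} Y_{d,n}(q)\to\mathbb{C}[z,x_1,\dots,x_{d-1}]$ be the Juyumaya trace, that is, the unique linear map with $\mathrm{tr}_d(ab)=\mathrm{tr}_d(ba)$, $\mathrm{tr}_d(1)=1$, and, for $a\in Y_{d,n}(q)$, $\mathrm{tr}_d(ag_n)=z\,\mathrm{tr}_d(a)$ and $\mathrm{tr}_d(at_{n+1}^s)=x_s\,\mathrm{tr}_d(a)$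 for $1\le s\le d-1$. Let $X_D=(\mathrm x_1,\dots,\mathrm x_{d-1})\in\mathbb{C}^{d-1}$ be a solution of the E--system $E^{(m)}=\mathrm x_mE$ ($1\le m\le d-1$), where $E^{(m)}=\frac1d\sum_{s=0}^{d-1}\mathrm x_{m+s}\mathrm x_{d-s}$ and $E=E^{(0)}$, with indices modulo $d$ and $\mathrm x_0=1$ (the solutions are parametrized by the non-empty subsets $D$ of $\mathbb Z/d\mathbb Z$). Write $E_D$ for the value of $E$ at $X_D$ (it equals $1/|D|$), and $\mathrm{tr}_{d,D}$ for $\mathrm{tr}_d$ with $x_s$ specialized to $\mathrm x_s$. Put $\lambda_D=\frac{z-(q-q^{-1})E_D}{z}$ and, for $\alpha\in B_n$ with exponent sum $\epsilon(\alpha)$ and closure $\widehat\alpha$, $$\Theta_{d,D}(q,z)(\widehat\alpha)=\Big(\frac{1}{z\sqrt{\lambda_D}}\Big)^{n-1}\big(\sqrt{\lambda_D}\big)^{\epsilon(\alpha)}\,\mathrm{tr}_{d,D}(\alpha),$$ where $\alpha$ is mapped to $Y_{d,n}(q)$ by $\sigma_i\mapsto g_i$. The Homflypt polynomial is $P(q,z)=\Theta_{1,\{0\}}(q,z)$;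 here $Y_{1,n}(q)$ is the Iwahori--Hecke algebra and $\mathrm{tr}_{1,\{0\}}$ the Ocneanu trace. Theorem. If $\alpha\in B_n$ and $\widehat\alpha$ is a knot, then $$\Theta_{d,D}(q,z)(\widehat\alpha)=\Theta_{1,\{0\}}(q,z/E_D)(\widehat\alpha)=P(q,z/E_D)(\widehat\alpha).$$ Here $z$ may be an indeterminate or any element of an extension field of $\mathbb{C}$ with $z\ne0$ and $\lambda_D\neq 0$; the equality holds for every choice of the square root on each side. Equivalently, if $q^2\neq1$, in the variables $(q,\lambda)$ the invariant equals the Homflypt polynomial: for $\lambda\ne 0,1$, the value of $\Theta_{d,D}$ on $\widehat\alpha$ at $z=\frac{(q-q^{-1})E_D}{1-\lambda}$ equals the value of $P$ on $\widehat\alpha$ at $z=\frac{q-q^{-1}}{1-\lambda}$. -/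

import Mathlib

noncomputable section

namespace YH

/-- The left strand `i` of the `i`-th elementary braid on `n` strands. -/
def lo {n : ℕ} (i : Fin (n - 1)) : Fin n := ⟨i.1, by omega⟩

/-- The right strand `i + 1` of the `i`-th elementary braid on `n` strands. -/
def hi {n : ℕ} (i : Fin (n - 1)) : Fin n := ⟨i.1 + 1, by omega⟩

/-- The transposition `s_i = (i, i + 1)`. -/
def sTr {n : ℕ} (i : Fin (n - 1)) : Equiv.Perm (Fin n) := Equiv.swap (lo i) (hi i)

/-! ### The classical braid group -/

/-- The braid relations, as words in the free group (`u = v` is recorded as `u * v⁻¹`). -/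
inductive BraidRel (n : ℕ) : FreeGroup (Fin (n - 1)) → Prop
  | braid (i j : Fin (n - 1)) (h : j.1 = i.1 + 1) :
      BraidRel n (FreeGroup.of i * FreeGroup.of j * FreeGroup.of i *
        (FreeGroup.of j * FreeGroup.of i * FreeGroup.of j)⁻¹)
  | comm (i j : Fin (n - 1)) (h : i.1 + 1 < j.1) :
      BraidRel n (FreeGroup.of i * FreeGroup.of j * (FreeGroup.of j * FreeGroup.of i)⁻¹)

/-- The braid group `B_n` on `n` strands. -/
abbrev BraidGroup (n : ℕ) : Type := PresentedGroup {w | BraidRel n w}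

/-! ### The modular framed braid group -/

/-- The word `σ_i` in the free group on the symbols `σ_i`, `t_j`. -/
def fσ {n : ℕ} (i : Fin (n - 1)) : FreeGroup (Fin (n - 1) ⊕ Fin n) := FreeGroup.of (Sum.inl i)

/-- The word `t_j` in the free group on the symbols `σ_i`, `t_j`. -/
def ft {n : ℕ} (j : Fin n) : FreeGroup (Fin (n - 1) ⊕ Fin n) := FreeGroup.of (Sum.inr j)

/-- The defining relations of the modular framed braid group. -/
inductive FramedRel (d n : ℕ) : FreeGroup (Fin (n - 1) ⊕ Fin n) → Prop
  | braid (i j : Fin (n - 1)) (h : j.1 = i.1 + 1) :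
      FramedRel d n (fσ i * fσ j * fσ i * (fσ j * fσ i * fσ j)⁻¹)
  | comm (i j : Fin (n - 1)) (h : i.1 + 1 < j.1) :
      FramedRel d n (fσ i * fσ j * (fσ j * fσ i)⁻¹)
  | framing (i j : Fin n) : FramedRel d n (ft i * ft j * (ft j * ft i)⁻¹)
  | mixed (i : Fin (n - 1)) (j : Fin n) :
      FramedRel d n (ft j * fσ i * (fσ i * ft (sTr i j))⁻¹)
  | modular (j : Fin n) : FramedRel d n (ft j ^ d)

/-- The modular framed braid group `F_{d,n} ≅ (ℤ/d)^n ⋊ B_n`. -/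
abbrev FramedBraidGroup (d n : ℕ) : Type := PresentedGroup {w | FramedRel d n w}

/-- The braiding generator `σ_i` of `F_{d,n}`. -/
def σF (d : ℕ) {n : ℕ} (i : Fin (n - 1)) : FramedBraidGroup d n := PresentedGroup.of (Sum.inl i)

/-- The framing generator `t_j` of `F_{d,n}`. -/
def tF (d : ℕ) {n : ℕ} (j : Fin n) : FramedBraidGroup d n := PresentedGroup.of (Sum.inr j)

theorem mk_fσ (d : ℕ) {n : ℕ} (i : Fin (n - 1)) :
    PresentedGroup.mk {w | FramedRel d n w} (fσ i) = σF d i := rfl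

theorem mk_ft (d : ℕ) {n : ℕ} (j : Fin n) :
    PresentedGroup.mk {w | FramedRel d n w} (ft j) = tF d j := rfl

theorem framed_rel {d n : ℕ} {w : FreeGroup (Fin (n - 1) ⊕ Fin n)} (h : FramedRel d n w) :
    PresentedGroup.mk {w | FramedRel d n w} w = 1 :=
  PresentedGroup.one_of_mem h

theorem σF_braid (d : ℕ) {n : ℕ} (i j : Fin (n - 1)) (h : j.1 = i.1 + 1) :
    σF d i * σF d j * σF d i = σF d j * σF d i * σF d j := by
  have := framed_rel (FramedRel.braid (d := d) i j h)
  simp only [map_mul, map_inv, mk_fσ] at this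
  exact mul_inv_eq_one.mp this

theorem σF_comm (d : ℕ) {n : ℕ} (i j : Fin (n - 1)) (h : i.1 + 1 < j.1) :
    σF d i * σF d j = σF d j * σF d i := by
  have := framed_rel (FramedRel.comm (d := d) i j h)
  simp only [map_mul, map_inv, mk_fσ] at this
  exact mul_inv_eq_one.mp this

theorem tF_comm (d : ℕ) {n : ℕ} (i j : Fin n) : tF d i * tF d j = tF d j * tF d i := by
  have := framed_rel (FramedRel.framing (d := d) i j)
  simp only [map_mul, map_inv, mk_ft] at this
  exact mul_inv_eq_one.mp this

theorem tF_σF (d : ℕ) {n : ℕ} (i : Fin (n - 1)) (j : Fin n) :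
    tF d j * σF d i = σF d i * tF d (sTr i j) := by
  have := framed_rel (FramedRel.mixed (d := d) i j)
  simp only [map_mul, map_inv, mk_ft, mk_fσ] at this
  exact mul_inv_eq_one.mp this

theorem tF_pow (d : ℕ) {n : ℕ} (j : Fin n) : tF d j ^ d = 1 := by
  have := framed_rel (FramedRel.modular (d := d) j)
  simpa only [map_pow, mk_ft] using this

/-! ### Maps out of the braid group -/

/-- `B_n → F_{d,n}`, `σ_i ↦ σ_i`: a classical braid is a framed braid with all framings zero. -/
def braidToFramed (d n : ℕ) : BraidGroup n →* FramedBraidGroup d n :=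
  PresentedGroup.toGroup (f := fun i => σF d i) (by
    rintro w (⟨i, j, h⟩ | ⟨i, j, h⟩)
    · simpa only [map_mul, map_inv, FreeGroup.lift_apply_of, mul_inv_eq_one] using σF_braid d i j h
    · simpa only [map_mul, map_inv, FreeGroup.lift_apply_of, mul_inv_eq_one] using σF_comm d i j h)

/-- The permutation of the strands induced by a braid, `σ_i ↦ (i, i + 1)`. -/
def braidPerm (n : ℕ) : BraidGroup n →* Equiv.Perm (Fin n) :=
  PresentedGroup.toGroup (f := fun i => sTr i) (by
    rintro w (⟨i, j, h⟩ | ⟨i, j, h⟩)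
    · simp only [map_mul, map_inv, FreeGroup.lift_apply_of, mul_inv_eq_one]
      have h1 : lo j = hi i := Fin.ext h
      have h2 : lo i ≠ hi i := by simp [lo, hi, Fin.ext_iff]
      have h3 : lo i ≠ hi j := by simp [lo, hi, Fin.ext_iff]; omega
      have h4 : hi i ≠ hi j := by simp [hi, Fin.ext_iff]; omega
      simp only [sTr, h1]
      rw [Equiv.swap_mul_swap_mul_swap h2 h3, Equiv.swap_comm (lo i) (hi i),
        Equiv.swap_comm (hi i) (hi j), Equiv.swap_mul_swap_mul_swap h4.symm h3.symm]
      exact Equiv.swap_comm _ _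
    · simp only [map_mul, map_inv, FreeGroup.lift_apply_of, mul_inv_eq_one]
      refine (Equiv.Perm.Disjoint.commute ?_).eq
      intro k
      by_cases hk : k = lo i ∨ k = hi i
      · right
        refine Equiv.swap_apply_of_ne_of_ne ?_ ?_ <;>
          (rcases hk with rfl | rfl <;> simp [lo, hi, Fin.ext_iff] <;> omega)
      · left
        push Not at hk
        exact Equiv.swap_apply_of_ne_of_ne hk.1 hk.2)

/-- The algebraic sum `ε` of the exponents of the `σ_i` in a braid (written multiplicatively). -/
def braidExpHom (n : ℕ) : BraidGroup n →* Multiplicative ℤ :=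
  PresentedGroup.toGroup (f := fun _ => Multiplicative.ofAdd (1 : ℤ)) (by
    rintro w (⟨i, j, h⟩ | ⟨i, j, h⟩) <;>
      simp only [map_mul, map_inv, FreeGroup.lift_apply_of, mul_inv_cancel])

/-- The exponent sum `ε(α)`. -/
def expSum {n : ℕ} (α : BraidGroup n) : ℤ := Multiplicative.toAdd (braidExpHom n α)

/-- The components of the closure of a braid. Closing up joins the end of each strand to the start
of the strand that sits at the same position, so that a component is an orbit of strands under
the induced permutation. -/
abbrev ClosureComponent {n : ℕ} (α : BraidGroup n) : Type :=
  MulAction.orbitRel.Quotient (Subgroup.zpowers (braidPerm n α)) (Fin n)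

/-- The closure of `α` is a knot: a link with exactly one component. -/
def ClosureIsKnot {n : ℕ} (α : BraidGroup n) : Prop := Nat.card (ClosureComponent α) = 1

/-! ### The Yokonuma–Hecke algebra -/

/-- The element `e_i = (1/d) ∑_{1 ≤ s ≤ d} t_i^s t_{i+1}^{-s}` of the group algebra of `F_{d,n}`. -/
def eF (d : ℕ) {n : ℕ} (i : Fin (n - 1)) : MonoidAlgebra ℂ (FramedBraidGroup d n) :=
  (1 / (d : ℂ)) • ∑ s ∈ Finset.Icc 1 d,
    MonoidAlgebra.of ℂ (FramedBraidGroup d n) (tF d (lo i) ^ s * (tF d (hi i) ^ s)⁻¹)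

/-- The quadratic relations `σ_i² = 1 + (q - q⁻¹) e_i σ_i`. -/
inductive QuadRel (d n : ℕ) (q : ℂ) : MonoidAlgebra ℂ (FramedBraidGroup d n) →
    MonoidAlgebra ℂ (FramedBraidGroup d n) → Prop
  | quad (i : Fin (n - 1)) :
      QuadRel d n q (MonoidAlgebra.of ℂ (FramedBraidGroup d n) (σF d i) ^ 2)
        (1 + (q - q⁻¹) • (eF d i * MonoidAlgebra.of ℂ (FramedBraidGroup d n) (σF d i)))

/-- The Yokonuma–Hecke algebra `Y_{d,n}(q)`: the quotient of the group algebra of `F_{d,n}` by the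
two-sided ideal generated by the quadratic relations. -/
abbrev Y (d n : ℕ) (q : ℂ) : Type := RingQuot (QuadRel d n q)

/-- The natural epimorphism from the group algebra of `F_{d,n}` onto `Y_{d,n}(q)`. -/
def toY (d n : ℕ) (q : ℂ) : MonoidAlgebra ℂ (FramedBraidGroup d n) →ₐ[ℂ] Y d n q :=
  RingQuot.mkAlgHom ℂ (QuadRel d n q)

/-- The natural map from `F_{d,n}` to `Y_{d,n}(q)`. -/
def framedToY (d n : ℕ) (q : ℂ) : FramedBraidGroup d n →* Y d n q :=
  (toY d n q : MonoidAlgebra ℂ (FramedBraidGroup d n) →* Y d n q).comp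
    (MonoidAlgebra.of ℂ (FramedBraidGroup d n))

/-- The generator `g_i` of `Y_{d,n}(q)`. -/
def g (d : ℕ) {n : ℕ} (q : ℂ) (i : Fin (n - 1)) : Y d n q := framedToY d n q (σF d i)

/-- The generator `t_j` of `Y_{d,n}(q)`. -/
def t (d : ℕ) {n : ℕ} (q : ℂ) (j : Fin n) : Y d n q := framedToY d n q (tF d j)

/-- The map `δ` on braids: `σ_i ↦ g_i`. -/
def δ (d n : ℕ) (q : ℂ) : BraidGroup n →* Y d n q := (framedToY d n q).comp (braidToFramed d n)

/-! ### The inclusions `Y_{d,n}(q) ⊂ Y_{d,n+1}(q)` -/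

/-- The `i`-th elementary braid, with one more strand added on the right. -/
def up {n : ℕ} (i : Fin (n - 1)) : Fin (n + 1 - 1) := ⟨i.1, by omega⟩

theorem sTr_up {n : ℕ} (i : Fin (n - 1)) (j : Fin n) :
    sTr (up i) j.castSucc = (sTr i j).castSucc := by
  have h1 : lo (up i) = (lo i).castSucc := rfl
  have h2 : hi (up i) = (hi i).castSucc := rfl
  simp only [sTr, h1, h2]
  exact (Fin.castSucc_injective n).swap_apply _ _ _

/-- The natural map `F_{d,n} → F_{d,n+1}`, `σ_i ↦ σ_i`, `t_j ↦ t_j`. -/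
def inclF (d n : ℕ) : FramedBraidGroup d n →* FramedBraidGroup d (n + 1) :=
  PresentedGroup.toGroup (f := Sum.elim (fun i => σF d (up i)) (fun j => tF d j.castSucc)) (by
    rintro w (⟨i, j, h⟩ | ⟨i, j, h⟩ | ⟨i, j⟩ | ⟨i, j⟩ | ⟨j⟩) <;>
      simp only [fσ, ft, map_mul, map_inv, map_pow, FreeGroup.lift_apply_of, Sum.elim_inl,
        Sum.elim_inr, mul_inv_eq_one]
    · exact σF_braid d _ _ h
    · exact σF_comm d _ _ h
    · exact tF_comm d _ _
    · rw [tF_σF, sTr_up]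
    · exact tF_pow d _)

theorem inclF_σF (d n : ℕ) (i : Fin (n - 1)) : inclF d n (σF d i) = σF d (up i) :=
  PresentedGroup.toGroup.of _

theorem inclF_tF (d n : ℕ) (j : Fin n) : inclF d n (tF d j) = tF d j.castSucc :=
  PresentedGroup.toGroup.of _

/-- The map induced by `F_{d,n} → F_{d,n+1}` on group algebras. -/
def inclA (d n : ℕ) : MonoidAlgebra ℂ (FramedBraidGroup d n) →ₐ[ℂ]
    MonoidAlgebra ℂ (FramedBraidGroup d (n + 1)) :=
  MonoidAlgebra.lift ℂ (MonoidAlgebra ℂ (FramedBraidGroup d (n + 1))) (FramedBraidGroup d n)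
    ((MonoidAlgebra.of ℂ (FramedBraidGroup d (n + 1))).comp (inclF d n))

theorem inclA_of (d n : ℕ) (w : FramedBraidGroup d n) :
    inclA d n (MonoidAlgebra.of ℂ (FramedBraidGroup d n) w) =
      MonoidAlgebra.of ℂ (FramedBraidGroup d (n + 1)) (inclF d n w) := by
  rw [inclA, MonoidAlgebra.lift_of]; rfl

theorem inclA_eF (d n : ℕ) (i : Fin (n - 1)) : inclA d n (eF d i) = eF d (up i) := by
  simp only [eF, map_smul, map_sum, inclA_of]
  simp only [map_mul, map_inv, map_pow, inclF_tF]
  rfl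

/-- The natural inclusion `Y_{d,n}(q) → Y_{d,n+1}(q)`. -/
def incl (d n : ℕ) (q : ℂ) : Y d n q →ₐ[ℂ] Y d (n + 1) q :=
  RingQuot.liftAlgHom ℂ ⟨(toY d (n + 1) q).comp (inclA d n), by
    rintro _ _ ⟨i⟩
    simp only [AlgHom.comp_apply, map_pow, map_add, map_one, map_smul, map_mul, inclA_of,
      inclA_eF, inclF_σF]
    have := RingQuot.mkAlgHom_rel ℂ (QuadRel.quad (d := d) (n := n + 1) (q := q) (up i))
    simp only [map_pow, map_add, map_one, map_smul, map_mul] at this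
    exact this⟩

/-! ### Markov traces -/

/-- The rules of a Markov trace on `⋃ₙ Y_{d,n}(q)` with parameters `z` and `x_s`. A linear map on the
union is a family of linear maps on the `Y_{d,n}(q)` compatible with the inclusions. -/
structure IsMarkovTrace (d : ℕ) (q : ℂ) {R : Type} [CommRing R] [Algebra ℂ R] (z : R)
    (x : ZMod d → R) (tr : (n : ℕ) → Y d n q →ₗ[ℂ] R) : Prop where
  compat : ∀ (n : ℕ) (a : Y d n q), tr (n + 1) (incl d n q a) = tr n a
  comm : ∀ (n : ℕ) (a b : Y d n q), tr n (a * b) = tr n (b * a)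
  one : ∀ n : ℕ, tr n 1 = 1
  markov : ∀ (n : ℕ) (a : Y d (n + 1) q),
    tr (n + 2) (incl d (n + 1) q a * g d q (n := n + 2) (Fin.last n)) = z * tr (n + 1) a
  framing : ∀ (n : ℕ) (a : Y d n q) (s : ℕ), 1 ≤ s → s < d →
    tr (n + 1) (incl d n q a * t d q (Fin.last n) ^ s) = x (s : ZMod d) * tr n a

/-- The polynomial ring `ℂ[z, x_1, …, x_{d-1}]`; the variable `none` is `z` and `some s` is `x_s`. -/
abbrev TraceRing (d : ℕ) : Type := MvPolynomial (Option {s : ZMod d // s ≠ 0}) ℂ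

/-- The indeterminates `x_s`, with the convention `x_0 = 1`. -/
def xVar (d : ℕ) (s : ZMod d) : TraceRing d :=
  if h : s = 0 then 1 else MvPolynomial.X (some ⟨s, h⟩)

open Classical in
/-- The Juyumaya trace `tr_d`: the unique family of linear maps
`Y_{d,n}(q) → ℂ[z, x_1, …, x_{d-1}]` that obeys the rules of a Markov trace. -/
def juyumayaTrace (d : ℕ) (q : ℂ) : (n : ℕ) → Y d n q →ₗ[ℂ] TraceRing d :=
  if h : ∃ tr : (n : ℕ) → Y d n q →ₗ[ℂ] TraceRing d,
      IsMarkovTrace d q (MvPolynomial.X none) (xVar d) tr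
  then h.choose else fun _ => 0

/-! ### The E-system -/

/-- `E^{(m)} = (1/d) ∑_{0 ≤ s < d} x_{m+s} x_{d-s}`, with indices modulo `d`. -/
def Esum (d : ℕ) (x : ZMod d → ℂ) (m : ZMod d) : ℂ :=
  (1 / (d : ℂ)) * ∑ s ∈ Finset.range d, x (m + (s : ZMod d)) * x ((d : ZMod d) - (s : ZMod d))

/-- `E = E^{(0)}`. -/
def E (d : ℕ) (x : ZMod d → ℂ) : ℂ := Esum d x 0

/-- `(x_1, …, x_{d-1})`, extended by `x_0 = 1`, is a solution of the E-system. -/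
structure IsESolution (d : ℕ) (x : ZMod d → ℂ) : Prop where
  zero : x 0 = 1
  eqn : ∀ m : ZMod d, m ≠ 0 → Esum d x m = x m * E d x

/-- The trace `tr_d` with the parameters `x_s` specialized to complex numbers, with values in
`ℂ[z]`. -/
def specTrace (d : ℕ) (q : ℂ) (x : ZMod d → ℂ) (n : ℕ) : Y d n q →ₗ[ℂ] Polynomial ℂ :=
  (MvPolynomial.aeval (fun v : Option {s : ZMod d // s ≠ 0} =>
    v.elim Polynomial.X (fun s => Polynomial.C (x s.1)))).toLinearMap ∘ₗ juyumayaTrace d q n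

/-! ### The invariants -/

/-- `λ = (z - (q - q⁻¹) E) / z`. -/
def lam {K : Type*} [Field K] [Algebra ℂ K] (q E : ℂ) (z : K) : K :=
  (z - algebraMap ℂ K ((q - q⁻¹) * E)) / z

/-- The value of `Θ_{d,D}(q, z)` on the closure of `α ∈ B_n`,
`Λ^(n-1) (√λ)^ε(α) tr(δ(α))` with `Λ = 1 / (z √λ)`. Here `z` lies in an arbitrary extension
field of `ℂ` (for instance an indeterminate), and `r` is a square root of `λ` in that field. -/
def Theta {K : Type*} [Field K] [Algebra ℂ K] (d : ℕ) (q : ℂ) (x : ZMod d → ℂ) (z r : K)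
    {n : ℕ} (α : BraidGroup n) : K :=
  (1 / (z * r)) ^ ((n : ℤ) - 1) * r ^ expSum α *
    Polynomial.aeval z (specTrace d q x n (δ d n q α))

/-- The Homflypt polynomial `P(q, z)` of the closure of `α`: the invariant for `d = 1`, in which case
the algebras are the Iwahori–Hecke algebras and the trace is the Ocneanu trace. -/
def Homflypt {K : Type*} [Field K] [Algebra ℂ K] (q : ℂ) (z r : K) {n : ℕ} (α : BraidGroup n) : K :=
  Theta 1 q (fun _ => 1) z r α

end YH

end

/-!
The trace exists because it can be read off from tensor representations: on the tensor powers of a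
space graded by the colours `ℤ/d`, let `t_j` act by the colour of the `j`-th factor and `g_i` by the
standard Hecke braiding between equal colours and by the flip between different ones. Suitably
weighted traces of these operators satisfy the Markov rules, the reduction to fewer strands shows
that they depend polynomially on the parameters, and there are enough representations to pin these
polynomials down.

For the theorem, split `1` into the projections onto the colours of one strand. If the closure of
`α` is a knot, then conjugation by `α` permutes the strands transitively, so colouring one strand
gives the same trace as colouring all of them. On the part where all strands have the colour `k` the
algebra is the Iwahori–Hecke algebra, and by the uniqueness of Markov traces the trace is `c_k ^ n`
times the Ocneanu trace at `z / E_D`, where `c_k` is the Fourier coefficient of the solution of the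
E-system. It is `E_D` for `k ∈ D` and `0` otherwise, and `|D| = 1 / E_D`, so these contributions add
up to `E_D ^ (n - 1)`. The choices of the square roots do not matter because the permutation of `α`
is an `n`-cycle, whence `ε(α)` and `n - 1` have the same parity.
-/

noncomputable section

namespace YH

/-! ### Framed braid groups -/

section FramedBraidGroup

variable {d n : ℕ}

theorem framed_generated {H : Subgroup (FramedBraidGroup d n)} (hσ : ∀ i, σF d i ∈ H)
    (ht : ∀ j, tF d j ∈ H) (w : FramedBraidGroup d n) : w ∈ H :=
  PresentedGroup.generated_by _ H (Sum.rec hσ ht) w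

theorem framed_zero_eq_one (w : FramedBraidGroup d 0) : w = 1 :=
  framed_generated (H := ⊥) (fun i => absurd i.2 (by omega)) (fun j => j.elim0) w

theorem framedHom_ext {M : Type*} [Monoid M] {φ ψ : FramedBraidGroup d n →* M}
    (hσ : ∀ i, φ (σF d i) = ψ (σF d i)) (ht : ∀ j, φ (tF d j) = ψ (tF d j)) : φ = ψ := by
  ext w
  exact framed_generated (H := φ.eqLocus ψ) hσ ht w

theorem inv_tF [NeZero d] (j : Fin n) : (tF d j)⁻¹ = tF d j ^ (d - 1) := by
  rw [inv_eq_iff_mul_eq_one, ← pow_succ', Nat.sub_add_cancel NeZero.one_le, tF_pow]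

theorem framed_generated_submonoid [NeZero d] {M : Submonoid (FramedBraidGroup d n)}
    (hσ : ∀ i, σF d i ∈ M) (hσ' : ∀ i, (σF d i)⁻¹ ∈ M) (ht : ∀ j, tF d j ∈ M)
    (w : FramedBraidGroup d n) : w ∈ M := by
  have hw : w ∈ (Subgroup.closure (Set.range PresentedGroup.of)).toSubmonoid := by
    rw [PresentedGroup.closure_range_of]; exact Subgroup.mem_top w
  rw [Subgroup.closure_toSubmonoid] at hw
  refine Submonoid.closure_le.mpr (Set.union_subset ?_ ?_) hw
  · rintro _ ⟨i | j, rfl⟩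
    exacts [hσ i, ht j]
  · intro u hu
    obtain ⟨i | j, hu⟩ := Set.mem_inv.mp hu
    · exact inv_eq_iff_eq_inv.mp hu.symm ▸ hσ' i
    · have hj : (tF d j)⁻¹ ∈ M := by rw [inv_tF]; exact pow_mem (ht j) _
      exact inv_eq_iff_eq_inv.mp hu.symm ▸ hj

theorem commute_of_generators {M : Type*} [Monoid M] {φ : FramedBraidGroup d n →* M} {x : M}
    (hσ : ∀ i, Commute x (φ (σF d i))) (ht : ∀ j, Commute x (φ (tF d j)))
    (w : FramedBraidGroup d n) : Commute x (φ w) :=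
  framed_generated (H :=
    { carrier := {w | Commute x (φ w)}
      one_mem' := by rw [Set.mem_ofPred_eq, map_one]; exact Commute.one_right x
      mul_mem' := fun {u v} hu hv => by
        rw [Set.mem_ofPred_eq, map_mul]; exact Commute.mul_right hu hv
      inv_mem' := fun {u} hu => (show Commute x (φ.toHomUnits u) from hu).units_inv_right })
    hσ ht w

/-- The index of the last braiding generator of `F_{d,n+2}`. -/
abbrev top (n : ℕ) : Fin (n + 2 - 1) := Fin.last n

theorem eq_up_or_eq_top (i : Fin (n + 2 - 1)) : (∃ k : Fin (n + 1 - 1), i = up k) ∨ i = top n :=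
  Fin.lastCases (Or.inr rfl) (fun k => Or.inl ⟨k, rfl⟩) i

theorem sTr_lo (i : Fin (n - 1)) : sTr i (lo i) = hi i := Equiv.swap_apply_left _ _

theorem sTr_hi (i : Fin (n - 1)) : sTr i (hi i) = lo i := Equiv.swap_apply_right _ _

theorem sTr_of_val_ne {i : Fin (n - 1)} {j : Fin n} (hlo : j.1 ≠ i.1) (hhi : j.1 ≠ i.1 + 1) :
    sTr i j = j :=
  Equiv.swap_apply_of_ne_of_ne (Fin.ne_of_val_ne hlo) (Fin.ne_of_val_ne hhi)

theorem sTr_up_last (i : Fin (n - 1)) : sTr (up i) (Fin.last n) = Fin.last n :=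
  sTr_of_val_ne (show n ≠ i.1 by omega) (show n ≠ i.1 + 1 by omega)

theorem tF_castSucc_last_mul_σF_top (d n : ℕ) :
    tF d (Fin.last n).castSucc * σF d (n := n + 2) (top n) =
      σF d (n := n + 2) (top n) * tF d (Fin.last (n + 1)) := by
  rw [tF_σF]
  exact congrArg (_ * tF d ·) (sTr_lo (n := n + 2) (top n))

theorem tF_last_mul_σF_top (d n : ℕ) :
    tF d (Fin.last (n + 1)) * σF d (n := n + 2) (top n) =
      σF d (n := n + 2) (top n) * tF d (Fin.last n).castSucc := by
  rw [tF_σF]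
  exact congrArg (_ * tF d ·) (sTr_hi (n := n + 2) (top n))

theorem commute_tF_last_inclF (w : FramedBraidGroup d n) :
    Commute (tF d (Fin.last n)) (inclF d n w) := by
  refine commute_of_generators (fun i => ?_) (fun j => ?_) w
  · rw [Commute, SemiconjBy, inclF_σF, tF_σF, sTr_up_last]
  · rw [Commute, SemiconjBy, inclF_tF, tF_comm]

theorem commute_σF_top_inclF_inclF (w : FramedBraidGroup d n) :
    Commute (σF d (n := n + 2) (top n)) (inclF d (n + 1) (inclF d n w)) := by
  refine commute_of_generators (φ := (inclF d (n + 1)).comp (inclF d n)) (fun i => ?_)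
    (fun j => ?_) w
  · rw [MonoidHom.comp_apply, inclF_σF, inclF_σF]
    exact (σF_comm d (n := n + 2) (up (up i)) (top n) (show i.1 + 1 < n by omega)).symm
  · rw [MonoidHom.comp_apply, inclF_tF, inclF_tF]
    refine Commute.symm ?_
    rw [Commute, SemiconjBy, tF_σF,
      sTr_of_val_ne (show j.1 ≠ n by omega) (show j.1 ≠ n + 1 by omega)]

/-- The image `∑_{1 ≤ s ≤ d} t_i^s t_{i+1}^{-s}` of `d e_i` under a homomorphism to an algebra. -/
def framingSum {A : Type*} [Semiring A] (ρ : FramedBraidGroup d n →* A) (i : Fin (n - 1)) : A :=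
  ∑ s ∈ Finset.Icc 1 d, ρ (tF d (lo i) ^ s * (tF d (hi i) ^ s)⁻¹)

end FramedBraidGroup

/-! ### Towers of quotients of the group algebras -/

section RightStabilizer

variable {S A : Type*} [CommRing S] [Ring A] [Algebra S A]

/-- The subalgebra of the elements by which right multiplication preserves a given submodule. -/
def rightStabilizer (M : Submodule S A) : Subalgebra S A where
  carrier := {x | ∀ c ∈ M, c * x ∈ M}
  mul_mem' hx hy c hc := mul_assoc c _ _ ▸ hy _ (hx c hc)
  add_mem' hx hy c hc := mul_add c _ _ ▸ add_mem (hx c hc) (hy c hc)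
  algebraMap_mem' k c hc := by
    rw [← Algebra.commutes, ← Algebra.smul_def]; exact M.smul_mem k hc

theorem mem_rightStabilizer_span {s : Set A} {x : A} (h : ∀ c ∈ s, c * x ∈ Submodule.span S s) :
    x ∈ rightStabilizer (Submodule.span S s) := fun _ hc =>
  Submodule.span_le (p := (Submodule.span S s).comap (LinearMap.mulRight S x)).mpr h hc

end RightStabilizer

/-- A tower of algebras that receive the framed braid groups and in which the quadratic relations
`σ_i² = 1 + κ ∑_s t_i^s t_{i+1}^{-s} σ_i` hold. The Yokonuma–Hecke algebras form such a tower with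
`κ = (q - q⁻¹) / d`, and so do the tensor representations below. -/
structure Tower (S : Type*) [CommRing S] (d : ℕ) (κ : S) (A : ℕ → Type*) [∀ n, Ring (A n)]
    [∀ n, Algebra S (A n)] where
  /-- The map from the framed braid group. -/
  ρ : ∀ n, FramedBraidGroup d n →* A n
  /-- The structure maps of the tower. -/
  ι : ∀ n, A n →ₐ[S] A (n + 1)
  ι_ρ : ∀ n w, ι n (ρ n w) = ρ (n + 1) (inclF d n w)
  quad : ∀ n (i : Fin (n - 1)), ρ n (σF d i) * ρ n (σF d i) =
    1 + κ • (framingSum (ρ n) i * ρ n (σF d i))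

namespace Tower

variable {S : Type*} [CommRing S] {d : ℕ} {κ : S} {A : ℕ → Type*} [∀ n, Ring (A n)]
  [∀ n, Algebra S (A n)] (T : Tower S d κ A) {n : ℕ}

/-- The image of the group algebra of the framed braid group on `n` strands. -/
def image (n : ℕ) : Subalgebra S (A n) := Algebra.adjoin S (Set.range (T.ρ n))

/-- The last braiding generator on `n + 2` strands. -/
def g (n : ℕ) : A (n + 2) := T.ρ (n + 2) (σF d (top n))

/-- The last framing generator on `n + 1` strands. -/
def t (n : ℕ) : A (n + 1) := T.ρ (n + 1) (tF d (Fin.last n))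

theorem ρ_mem (w : FramedBraidGroup d n) : T.ρ n w ∈ T.image n :=
  Algebra.subset_adjoin ⟨w, rfl⟩

theorem g_mem : T.g n ∈ T.image (n + 2) := T.ρ_mem _

theorem t_mem : T.t n ∈ T.image (n + 1) := T.ρ_mem _

theorem image_toSubmodule_eq_span :
    Subalgebra.toSubmodule (T.image n) = Submodule.span S (Set.range (T.ρ n)) := by
  refine Algebra.adjoin_eq_span_of_subset S ?_
  rw [← MonoidHom.coe_mrange, Submonoid.closure_eq]
  exact Submodule.subset_span

theorem ι_mem {a : A n} (ha : a ∈ T.image n) : T.ι n a ∈ T.image (n + 1) := by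
  refine Algebra.adjoin_le (S := (T.image (n + 1)).comap (T.ι n)) ?_ ha
  rintro _ ⟨w, rfl⟩
  rw [SetLike.mem_coe, Subalgebra.mem_comap, T.ι_ρ]
  exact T.ρ_mem _

theorem commute_ι_t {a : A n} (ha : a ∈ T.image n) : Commute (T.ι n a) (T.t n) := by
  refine Subalgebra.mem_centralizer_iff S |>.mp (Algebra.adjoin_le
    (S := (Subalgebra.centralizer S {T.t n}).comap (T.ι n)) ?_ ha) _ rfl |>.symm
  rintro _ ⟨w, rfl⟩
  rw [SetLike.mem_coe, Subalgebra.mem_comap, T.ι_ρ, Subalgebra.mem_centralizer_iff]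
  rintro _ rfl
  exact (commute_tF_last_inclF w).map (T.ρ (n + 1))

theorem commute_ι_ι_g {a : A n} (ha : a ∈ T.image n) :
    Commute (T.ι (n + 1) (T.ι n a)) (T.g n) := by
  refine Subalgebra.mem_centralizer_iff S |>.mp (Algebra.adjoin_le
    (S := (Subalgebra.centralizer S {T.g n}).comap ((T.ι (n + 1)).comp (T.ι n))) ?_ ha) _ rfl
    |>.symm
  rintro _ ⟨w, rfl⟩
  rw [SetLike.mem_coe, Subalgebra.mem_comap, AlgHom.comp_apply, T.ι_ρ, T.ι_ρ,
    Subalgebra.mem_centralizer_iff]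
  rintro _ rfl
  exact (commute_σF_top_inclF_inclF w).map (T.ρ (n + 2))

theorem ι_t : T.ι (n + 1) (T.t n) = T.ρ (n + 2) (tF d (Fin.last n).castSucc) := by
  rw [t, ι_ρ, inclF_tF]

theorem t_pow_mul_g (s : ℕ) : T.t (n + 1) ^ s * T.g n = T.g n * T.ι (n + 1) (T.t n ^ s) := by
  have h : SemiconjBy (T.g n) (T.ι (n + 1) (T.t n)) (T.t (n + 1)) := by
    rw [SemiconjBy, ι_t, g, t, ← map_mul, ← map_mul, tF_last_mul_σF_top]
  rw [map_pow]
  exact (h.pow_right s).symm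

theorem g_mul_t : T.g n * T.t (n + 1) = T.ι (n + 1) (T.t n) * T.g n := by
  rw [ι_t, g, t, ← map_mul, ← map_mul, tF_castSucc_last_mul_σF_top]

theorem g_braid : T.g (n + 1) * T.ι (n + 2) (T.g n) * T.g (n + 1) =
    T.ι (n + 2) (T.g n) * T.g (n + 1) * T.ι (n + 2) (T.g n) := by
  rw [g, g, ι_ρ, inclF_σF]
  simp only [← map_mul]
  rw [σF_braid d (n := n + 3) (up (top n)) (top (n + 1)) (by simp [up])]

/-- The span of the elements `a t_{n+1}^s` with `a` in the `n`-th algebra. -/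
def framingSpan (n : ℕ) : Submodule S (A (n + 1)) :=
  Submodule.span S {c | ∃ a ∈ T.image n, ∃ s : ℕ, c = T.ι n a * T.t n ^ s}

/-- The standard elements of the `(n+1)`-st algebra: `a t_{n+1}^s` and `a g_n b` with `a`, `b` in
the `n`-th algebra. -/
inductive IsStd : ∀ {n : ℕ}, A (n + 1) → Prop
  | framing {n : ℕ} {a : A n} (ha : a ∈ T.image n) (s : ℕ) : IsStd (T.ι n a * T.t n ^ s)
  | braiding {n : ℕ} {a b : A (n + 1)} (ha : a ∈ T.image (n + 1)) (hb : b ∈ T.image (n + 1)) :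
      IsStd (T.ι (n + 1) a * T.g n * T.ι (n + 1) b)

/-- The span of the standard elements. -/
def stdSpan (n : ℕ) : Submodule S (A (n + 1)) := Submodule.span S {c | T.IsStd c}

variable {T}

theorem IsStd.mem_stdSpan {c : A (n + 1)} (hc : T.IsStd c) : c ∈ T.stdSpan n :=
  Submodule.subset_span hc

variable (T)

theorem framingSpan_le_stdSpan : T.framingSpan n ≤ T.stdSpan n :=
  Submodule.span_mono <| by rintro _ ⟨a, ha, s, rfl⟩; exact .framing ha s

theorem ι_mul_t_pow_mem_framingSpan {a : A n} (ha : a ∈ T.image n) (s : ℕ) :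
    T.ι n a * T.t n ^ s ∈ T.framingSpan n := Submodule.subset_span ⟨a, ha, s, rfl⟩

theorem t_last_mem_rightStabilizer_framingSpan :
    T.t n ∈ rightStabilizer (T.framingSpan n) := by
  refine mem_rightStabilizer_span ?_
  rintro _ ⟨a, ha, s, rfl⟩
  rw [mul_assoc, ← pow_succ]
  exact T.ι_mul_t_pow_mem_framingSpan ha _

theorem ι_mem_rightStabilizer_framingSpan {x : A n} (hx : x ∈ T.image n) :
    T.ι n x ∈ rightStabilizer (T.framingSpan n) := by
  refine mem_rightStabilizer_span ?_
  rintro _ ⟨a, ha, s, rfl⟩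
  rw [mul_assoc, ← ((T.commute_ι_t hx).pow_right s).eq, ← mul_assoc, ← map_mul]
  exact T.ι_mul_t_pow_mem_framingSpan (mul_mem ha hx) _

theorem t_last_mem_rightStabilizer_stdSpan : T.t n ∈ rightStabilizer (T.stdSpan n) := by
  refine mem_rightStabilizer_span ?_
  rintro _ (⟨ha, s⟩ | @⟨n, a, b, ha, hb⟩)
  · exact T.framingSpan_le_stdSpan (T.t_last_mem_rightStabilizer_framingSpan _
      (T.ι_mul_t_pow_mem_framingSpan ha s))
  · have : T.ι _ a * T.g n * T.ι _ b * T.t _ = T.ι _ (a * T.t n) * T.g n * T.ι _ b := by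
      rw [mul_assoc, (T.commute_ι_t hb).eq, ← mul_assoc, mul_assoc (T.ι _ a), g_mul_t, map_mul,
        ← mul_assoc]
    rw [this]
    exact (IsStd.braiding (mul_mem ha T.t_mem) hb).mem_stdSpan

theorem ι_mem_rightStabilizer_stdSpan {x : A n} (hx : x ∈ T.image n) :
    T.ι n x ∈ rightStabilizer (T.stdSpan n) := by
  refine mem_rightStabilizer_span ?_
  rintro _ (⟨ha, s⟩ | ⟨ha, hb⟩)
  · exact T.framingSpan_le_stdSpan (T.ι_mem_rightStabilizer_framingSpan hx _
      (T.ι_mul_t_pow_mem_framingSpan ha s))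
  · rw [mul_assoc, ← map_mul]
    exact (IsStd.braiding ha (mul_mem hb hx)).mem_stdSpan

theorem ρ_tF_mem {M : Subalgebra S (A (n + 1))} (ht : T.t n ∈ M)
    (hι : ∀ x ∈ T.image n, T.ι n x ∈ M) (j : Fin (n + 1)) : T.ρ (n + 1) (tF d j) ∈ M := by
  induction j using Fin.lastCases with
  | last => exact ht
  | cast j => rw [← inclF_tF, ← ι_ρ]; exact hι _ (T.ρ_mem _)

theorem framingSum_mem [NeZero d] {M : Subalgebra S (A n)} (ht : ∀ j, T.ρ n (tF d j) ∈ M)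
    (i : Fin (n - 1)) : framingSum (T.ρ n) i ∈ M := by
  refine sum_mem fun s _ => ?_
  rw [← inv_pow, inv_tF, map_mul, map_pow, map_pow, map_pow]
  exact mul_mem (pow_mem (ht _) s) (pow_mem (pow_mem (ht _) _) s)

theorem mul_g_mem_stdSpan {c : A (n + 2)} (hc : c ∈ T.framingSpan (n + 1)) :
    c * T.g n ∈ T.stdSpan (n + 1) := by
  refine Submodule.span_le (p := (T.stdSpan (n + 1)).comap (LinearMap.mulRight S (T.g n))).mpr
    ?_ hc
  rintro _ ⟨a, ha, s, rfl⟩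
  rw [SetLike.mem_coe, Submodule.mem_comap, LinearMap.mulRight_apply, mul_assoc, t_pow_mul_g,
    ← mul_assoc]
  exact (IsStd.braiding ha (pow_mem T.t_mem s)).mem_stdSpan

theorem mul_g_mul_ι_framing_mul_g_mem [NeZero d] {a : A (n + 1)} {b : A n}
    (ha : a ∈ T.image (n + 1)) (hb : b ∈ T.image n) (s : ℕ) :
    T.ι (n + 1) a * T.g n * T.ι (n + 1) (T.ι n b * T.t n ^ s) * T.g n ∈ T.stdSpan (n + 1) := by
  set c : A (n + 2) := T.ι (n + 1) (a * T.ι n b) * T.t (n + 1) ^ s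
  have hc : c ∈ T.framingSpan (n + 1) :=
    T.ι_mul_t_pow_mem_framingSpan (mul_mem ha (T.ι_mem hb)) s
  have he : c * framingSum (T.ρ (n + 2)) (top n) ∈ T.framingSpan (n + 1) :=
    T.framingSum_mem (T.ρ_tF_mem T.t_last_mem_rightStabilizer_framingSpan
      fun _ => T.ι_mem_rightStabilizer_framingSpan) _ c hc
  have : T.ι (n + 1) a * T.g n * T.ι (n + 1) (T.ι n b * T.t n ^ s) * T.g n =
      c + κ • (c * framingSum (T.ρ (n + 2)) (top n) * T.g n) :=
    calc _ = T.ι (n + 1) a * (T.g n * T.ι (n + 1) (T.ι n b)) * T.ι (n + 1) (T.t n ^ s) * T.g n := by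
          simp only [map_mul, mul_assoc]
      _ = T.ι (n + 1) (a * T.ι n b) * (T.g n * T.ι (n + 1) (T.t n ^ s)) * T.g n := by
          rw [← (T.commute_ι_ι_g hb).eq]; simp only [map_mul, mul_assoc]
      _ = c * (T.g n * T.g n) := by rw [← t_pow_mul_g]; simp only [c, mul_assoc]
      _ = _ := by rw [g, T.quad, mul_add, mul_one, mul_smul_comm, ← mul_assoc]
  rw [this]
  exact add_mem (T.framingSpan_le_stdSpan hc) (Submodule.smul_mem _ _ (T.mul_g_mem_stdSpan he))

theorem mul_g_mul_ι_braiding_mul_g_mem {a : A (n + 2)} {b b' : A (n + 1)}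
    (ha : a ∈ T.image (n + 2)) (hb : b ∈ T.image (n + 1)) (hb' : b' ∈ T.image (n + 1)) :
    T.ι (n + 2) a * T.g (n + 1) * T.ι (n + 2) (T.ι (n + 1) b * T.g n * T.ι (n + 1) b') *
      T.g (n + 1) ∈ T.stdSpan (n + 2) := by
  set β := T.ι (n + 2) (T.ι (n + 1) b)
  set β' := T.ι (n + 2) (T.ι (n + 1) b')
  have : T.ι (n + 2) a * T.g (n + 1) * T.ι (n + 2) (T.ι (n + 1) b * T.g n * T.ι (n + 1) b') *
      T.g (n + 1) = T.ι (n + 2) (a * T.ι (n + 1) b * T.g n) * T.g (n + 1) *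
        T.ι (n + 2) (T.g n * T.ι (n + 1) b') :=
    calc _ = T.ι (n + 2) a * (T.g (n + 1) * β) * T.ι (n + 2) (T.g n) * (β' * T.g (n + 1)) := by
          simp only [map_mul, mul_assoc, β, β']
      _ = T.ι (n + 2) a * β * (T.g (n + 1) * T.ι (n + 2) (T.g n) * T.g (n + 1)) * β' := by
          rw [(T.commute_ι_ι_g hb').eq, ← (T.commute_ι_ι_g hb).eq]; simp only [mul_assoc, β, β']
      _ = _ := by rw [g_braid]; simp only [map_mul, mul_assoc, β, β']
  rw [this]
  exact (IsStd.braiding (mul_mem (mul_mem ha (T.ι_mem hb)) T.g_mem)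
    (mul_mem T.g_mem (T.ι_mem hb'))).mem_stdSpan

theorem mul_g_mul_ι_mul_g_mem [NeZero d] {a b : A (n + 1)} (ha : a ∈ T.image (n + 1))
    (hb : b ∈ T.stdSpan n) :
    T.ι (n + 1) a * T.g n * T.ι (n + 1) b * T.g n ∈ T.stdSpan (n + 1) := by
  refine Submodule.span_le (p := (T.stdSpan (n + 1)).comap (LinearMap.mulRight S (T.g n) ∘ₗ
    LinearMap.mulLeft S (T.ι (n + 1) a * T.g n) ∘ₗ (T.ι (n + 1)).toLinearMap)).mpr ?_ hb
  rintro _ (⟨hc, s⟩ | ⟨hc, hc'⟩)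
  · exact T.mul_g_mul_ι_framing_mul_g_mem ha hc s
  · exact T.mul_g_mul_ι_braiding_mul_g_mem ha hc hc'

theorem g_mem_rightStabilizer_stdSpan [NeZero d]
    (h : Subalgebra.toSubmodule (T.image (n + 1)) ≤ T.stdSpan n) :
    T.g n ∈ rightStabilizer (T.stdSpan (n + 1)) := by
  refine mem_rightStabilizer_span ?_
  rintro _ (⟨ha, s⟩ | ⟨ha, hb⟩)
  · exact T.mul_g_mem_stdSpan (T.ι_mul_t_pow_mem_framingSpan ha s)
  · exact T.mul_g_mul_ι_mul_g_mem ha (h hb)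

theorem ρ_inv_σF (i : Fin (n - 1)) :
    T.ρ n (σF d i)⁻¹ = T.ρ n (σF d i) - κ • framingSum (T.ρ n) i := by
  have hinv : T.ρ n (σF d i) * T.ρ n (σF d i)⁻¹ = 1 := by rw [← map_mul, mul_inv_cancel, map_one]
  have h := congrArg (· * T.ρ n (σF d i)⁻¹) (T.quad n i)
  simp only [mul_assoc, add_mul, smul_mul_assoc, hinv, mul_one, one_mul] at h
  rw [h, add_sub_cancel_right]

theorem image_le_stdSpan_of_σF_mem [NeZero d]
    (hσ : ∀ i, T.ρ (n + 1) (σF d i) ∈ rightStabilizer (T.stdSpan n)) :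
    Subalgebra.toSubmodule (T.image (n + 1)) ≤ T.stdSpan n := by
  have ht (j) : T.ρ (n + 1) (tF d j) ∈ rightStabilizer (T.stdSpan n) :=
    T.ρ_tF_mem T.t_last_mem_rightStabilizer_stdSpan (fun _ => T.ι_mem_rightStabilizer_stdSpan) j
  have hσ' (i) : T.ρ (n + 1) (σF d i)⁻¹ ∈ rightStabilizer (T.stdSpan n) := by
    rw [T.ρ_inv_σF]
    exact sub_mem (hσ i) (Subalgebra.smul_mem _ (T.framingSum_mem ht i) κ)
  have hle : T.image (n + 1) ≤ rightStabilizer (T.stdSpan n) := Algebra.adjoin_le <| by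
    rintro _ ⟨w, rfl⟩
    exact framed_generated_submonoid
      (M := (rightStabilizer (T.stdSpan n)).toSubmonoid.comap (T.ρ (n + 1))) hσ hσ' ht w
  have one_mem : (1 : A (n + 1)) ∈ T.stdSpan n := by
    simpa using (IsStd.framing (T.image n).one_mem 0).mem_stdSpan
  intro x hx
  simpa using hle hx 1 one_mem

theorem image_le_stdSpan [NeZero d] (n : ℕ) :
    Subalgebra.toSubmodule (T.image (n + 1)) ≤ T.stdSpan n := by
  induction n with
  | zero => exact T.image_le_stdSpan_of_σF_mem fun i => i.elim0
  | succ n ih =>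
    refine T.image_le_stdSpan_of_σF_mem fun i => ?_
    rcases eq_up_or_eq_top i with ⟨k, rfl⟩ | rfl
    · rw [← inclF_σF, ← ι_ρ]; exact T.ι_mem_rightStabilizer_stdSpan (T.ρ_mem _)
    · exact T.g_mem_rightStabilizer_stdSpan ih

end Tower
/-! ### The coloured tensor representations -/

/-- The index set of the basis of a space with `N k` basis vectors of each colour `k`. -/
abbrev Vec {C : Type*} (N : C → ℕ) : Type _ := Σ k : C, Fin (N k)

/-- The matrices that act on the `n`-th tensor power of the space with basis `Vec N`. -/
abbrev Mat (K : Type*) {C : Type*} (N : C → ℕ) (n : ℕ) : Type _ :=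
  Matrix (Fin n → Vec N) (Fin n → Vec N) K

section BraidingCoefficients

theorem vec_ext {C : Type*} {N : C → ℕ} {a b : Vec N} (hfst : a.1 = b.1)
    (hsnd : a.2.1 = b.2.1) : a = b := by
  obtain ⟨k, i⟩ := a
  obtain ⟨l, j⟩ := b
  obtain rfl : k = l := hfst
  obtain rfl : i = j := Fin.ext hsnd
  rfl

theorem vec_snd_ne {C : Type*} {N : C → ℕ} {a b : Vec N} (h : a ≠ b) (hfst : a.1 = b.1) :
    a.2.1 ≠ b.2.1 := fun hsnd => h (vec_ext hfst hsnd)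

variable {C K : Type*} [DecidableEq C] [Field K] {N : C → ℕ} {v : K} {a b c : Vec N}

/-- The diagonal coefficient of the braiding `a ⊗ b ↦ brCoeff a b • a ⊗ b + b ⊗ a`: the flip on
vectors of different colours, and the Hecke-type `R`-matrix of Jimbo within a colour. -/
def brCoeff (v : K) (a b : Vec N) : K :=
  if a = b then v - 1 else if a.1 = b.1 ∧ b.2.1 < a.2.1 then v - v⁻¹ else 0

theorem brCoeff_self (a : Vec N) : brCoeff v a a = v - 1 := if_pos rfl

theorem brCoeff_of_ne (h : a ≠ b) :
    brCoeff v a b = if a.1 = b.1 ∧ b.2.1 < a.2.1 then v - v⁻¹ else 0 := if_neg h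

theorem brCoeff_of_fst_ne (h : a.1 ≠ b.1) : brCoeff v a b = 0 := by
  rw [brCoeff_of_ne (ne_of_apply_ne _ h), if_neg fun hab => h hab.1]

theorem brCoeff_mul_swap (h : a ≠ b) : brCoeff v a b * brCoeff v b a = 0 := by
  rw [brCoeff_of_ne h, brCoeff_of_ne h.symm]
  split_ifs <;> first | (exfalso; grind) | ring

theorem brCoeff_add_swap (h : a ≠ b) (hfst : a.1 = b.1) :
    brCoeff v a b + brCoeff v b a = v - v⁻¹ := by
  have := vec_snd_ne h hfst
  rw [brCoeff_of_ne h, brCoeff_of_ne h.symm]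
  split_ifs <;> first | (exfalso; grind) | ring

theorem brCoeff_sq (h : a ≠ b) : brCoeff v a b ^ 2 = (v - v⁻¹) * brCoeff v a b := by
  rw [brCoeff_of_ne h]
  split_ifs <;> ring

theorem brCoeff_triple_left (hab : a ≠ b) (hbc : b ≠ c) :
    brCoeff v a b * brCoeff v b c + brCoeff v a c * brCoeff v b a =
      brCoeff v b c * brCoeff v a c := by
  rcases eq_or_ne a c with rfl | hac
  · linear_combination brCoeff_mul_swap (v := v) hab
  have := vec_snd_ne hab
  rw [brCoeff_of_ne hab, brCoeff_of_ne hbc, brCoeff_of_ne hac, brCoeff_of_ne hab.symm]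
  clear hab hbc hac
  generalize a.2.1 = a₂, b.2.1 = b₂, c.2.1 = c₂ at *
  generalize a.1 = a₁, b.1 = b₁, c.1 = c₁ at *
  split_ifs <;> first | (exfalso; grind) | ring

theorem brCoeff_triple_right (hab : a ≠ b) (hbc : b ≠ c) :
    brCoeff v a b * brCoeff v a c = brCoeff v b c * brCoeff v a b +
      brCoeff v a c * brCoeff v c b := by
  rcases eq_or_ne a c with rfl | hac
  · linear_combination -brCoeff_mul_swap (v := v) hab
  have := vec_snd_ne hbc
  rw [brCoeff_of_ne hab, brCoeff_of_ne hbc, brCoeff_of_ne hac, brCoeff_of_ne hbc.symm]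
  clear hab hbc hac
  generalize a.2.1 = a₂, b.2.1 = b₂, c.2.1 = c₂ at *
  generalize a.1 = a₁, b.1 = b₁, c.1 = c₁ at *
  split_ifs <;> first | (exfalso; grind) | ring

/-- The difference of the two sides of the braid relation at `a ⊗ b ⊗ c`: here `x`, `y`, `z` are
the coefficients of that tensor and of its images under the two adjacent flips. -/
theorem brCoeff_braid (hv : v ≠ 0) (a b c : Vec N) {x y z : K} (hab : a = b → y = x)
    (hbc : b = c → z = x) :
    brCoeff v a b * brCoeff v b c * (brCoeff v a b - brCoeff v b c) * x +
      (brCoeff v a b * brCoeff v b c + brCoeff v a c * brCoeff v b a -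
        brCoeff v b c * brCoeff v a c) * y +
      (brCoeff v a b * brCoeff v a c - brCoeff v b c * brCoeff v a b -
        brCoeff v a c * brCoeff v c b) * z = 0 := by
  have hv' : v * v⁻¹ = 1 := mul_inv_cancel₀ hv
  by_cases h : a = b <;> by_cases h' : b = c
  · rw [hab h, hbc h']
    subst h h'
    ring
  · rw [hab h]
    subst h
    rw [brCoeff_self]
    linear_combination (-v * x) * brCoeff_sq (v := v) h' - z * brCoeff_mul_swap (v := v) h' +
      x * brCoeff v a c * hv'
  · rw [hbc h']
    subst h'
    rw [brCoeff_self]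
    linear_combination (v * x) * brCoeff_sq (v := v) h + y * brCoeff_mul_swap (v := v) h -
      x * brCoeff v a b * hv'
  · linear_combination y * brCoeff_triple_left (v := v) h h' +
      z * brCoeff_triple_right (v := v) h h' +
      x * brCoeff v b c * brCoeff_sq (v := v) h - x * brCoeff v a b * brCoeff_sq (v := v) h'

end BraidingCoefficients

section Transpositions

variable {n : ℕ}

theorem sTr_sTr (i : Fin (n - 1)) (j : Fin n) : sTr i (sTr i j) = j := Equiv.swap_apply_self _ _ _

theorem braidPerm_of (i : Fin (n - 1)) : braidPerm n (PresentedGroup.of i) = sTr i :=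
  PresentedGroup.toGroup.of _

theorem sTr_braid {i j : Fin (n - 1)} (h : j.1 = i.1 + 1) (k : Fin n) :
    sTr i (sTr j (sTr i k)) = sTr j (sTr i (sTr j k)) := by
  have h := congrArg (braidPerm n) (PresentedGroup.one_of_mem (BraidRel.braid i j h))
  simp only [map_mul, map_inv, map_one, mul_inv_eq_one, ← PresentedGroup.of.eq_1,
    braidPerm_of] at h
  exact DFunLike.congr_fun h k

theorem sTr_comm {i j : Fin (n - 1)} (h : i.1 + 1 < j.1) (k : Fin n) :
    sTr i (sTr j k) = sTr j (sTr i k) := by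
  have h := congrArg (braidPerm n) (PresentedGroup.one_of_mem (BraidRel.comm i j h))
  simp only [map_mul, map_inv, map_one, mul_inv_eq_one, ← PresentedGroup.of.eq_1,
    braidPerm_of] at h
  exact DFunLike.congr_fun h k

variable {β : Type*} (f : Fin n → β)

theorem comp_sTr_sTr (i : Fin (n - 1)) : (f ∘ sTr i) ∘ sTr i = f :=
  funext fun j => congrArg f (sTr_sTr i j)

theorem comp_sTr_of_eq {f : Fin n → β} {i : Fin (n - 1)} (h : f (lo i) = f (hi i)) :
    f ∘ sTr i = f := by
  rw [sTr, Equiv.comp_swap_eq_update]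
  simp [h]

theorem comp_sTr_braid {i j : Fin (n - 1)} (h : j.1 = i.1 + 1) :
    ((f ∘ sTr i) ∘ sTr j) ∘ sTr i = ((f ∘ sTr j) ∘ sTr i) ∘ sTr j :=
  funext fun k => congrArg f (sTr_braid h k)

theorem comp_sTr_comm {i j : Fin (n - 1)} (h : i.1 + 1 < j.1) :
    (f ∘ sTr i) ∘ sTr j = (f ∘ sTr j) ∘ sTr i :=
  funext fun k => congrArg f (sTr_comm h k)

end Transpositions

section Braiding

variable {C K : Type*} [DecidableEq C] [Fintype C] [Field K] {N : C → ℕ} {n : ℕ} (v : K)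

/-- The matrix of the `i`-th braiding generator. -/
def sigMat (N : C → ℕ) (i : Fin (n - 1)) : Mat K N n := Matrix.of fun f f' =>
  (if f = f' then brCoeff v (f (lo i)) (f (hi i)) else 0) + if f ∘ sTr i = f' then 1 else 0

/-- The projection onto the span of the tensors with equal colours at `i` and `i + 1`. -/
def eMat (K : Type*) [Field K] (N : C → ℕ) (i : Fin (n - 1)) : Mat K N n :=
  Matrix.diagonal fun f => if (f (lo i)).1 = (f (hi i)).1 then 1 else 0

theorem sigMat_mulVec (i : Fin (n - 1)) (x : (Fin n → Vec N) → K) (f : Fin n → Vec N) :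
    (sigMat v N i).mulVec x f = brCoeff v (f (lo i)) (f (hi i)) * x f + x (f ∘ sTr i) := by
  simp [Matrix.mulVec, dotProduct, sigMat, add_mul, Finset.sum_add_distrib]

theorem mul_sigMat (i : Fin (n - 1)) (X : Mat K N n) (f f' : Fin n → Vec N) :
    (X * sigMat v N i) f f' =
      X f f' * brCoeff v (f' (lo i)) (f' (hi i)) + X f (f' ∘ sTr i) := by
  have (g : Fin n → Vec N) : g ∘ sTr i = f' ↔ g = f' ∘ sTr i :=
    ⟨fun h => by rw [← h, comp_sTr_sTr], fun h => by rw [h, comp_sTr_sTr]⟩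
  simp [Matrix.mul_apply, sigMat, mul_add, Finset.sum_add_distrib, this]

theorem sigMat_braid {v : K} (hv : v ≠ 0) {i j : Fin (n - 1)} (h : j.1 = i.1 + 1) :
    sigMat v N i * sigMat v N j * sigMat v N i = sigMat v N j * sigMat v N i * sigMat v N j := by
  refine Matrix.ext_iff_mulVec.mpr fun x => funext fun f => ?_
  have hlo : lo j = hi i := Fin.ext h
  have hi_hi : sTr i (hi j) = hi j :=
    sTr_of_val_ne (by simp only [hi]; omega) (by simp only [hi]; omega)
  have hj_lo : sTr j (lo i) = lo i :=
    sTr_of_val_ne (by simp only [lo]; omega) (by simp only [lo]; omega)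
  have hj_mid : sTr j (hi i) = hi j := hlo ▸ sTr_lo j
  have hj_hi : sTr j (hi j) = hi i := hlo ▸ sTr_hi j
  have key := brCoeff_braid hv (f (lo i)) (f (hi i)) (f (hi j)) (x := x f)
    (fun e => congrArg x (comp_sTr_of_eq e))
    (fun e => congrArg x (comp_sTr_of_eq (i := j) (hlo ▸ e)))
  simp only [← Matrix.mulVec_mulVec, sigMat_mulVec, Function.comp_apply, hlo, sTr_lo, sTr_hi,
    hi_hi, hj_lo, hj_mid, hj_hi, comp_sTr_sTr, comp_sTr_braid f h]
  linear_combination key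

theorem sigMat_comm {i j : Fin (n - 1)} (h : i.1 + 1 < j.1) :
    sigMat v N i * sigMat v N j = sigMat v N j * sigMat v N i := by
  refine Matrix.ext_iff_mulVec.mpr fun x => funext fun f => ?_
  have hi_hi : sTr i (hi j) = hi j :=
    sTr_of_val_ne (by simp only [hi]; omega) (by simp only [hi]; omega)
  have hi_lo : sTr i (lo j) = lo j :=
    sTr_of_val_ne (by simp only [lo]; omega) (by simp only [lo]; omega)
  have hj_hi : sTr j (hi i) = hi i :=
    sTr_of_val_ne (by simp only [hi]; omega) (by simp only [hi]; omega)
  have hj_lo : sTr j (lo i) = lo i :=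
    sTr_of_val_ne (by simp only [lo]; omega) (by simp only [lo]; omega)
  simp only [← Matrix.mulVec_mulVec, sigMat_mulVec, Function.comp_apply, hi_hi, hi_lo, hj_hi,
    hj_lo, comp_sTr_comm f h]
  ring

theorem sigMat_mul_self {v : K} (hv : v ≠ 0) (i : Fin (n - 1)) :
    sigMat v N i * sigMat v N i = 1 + (v - v⁻¹) • (eMat K N i * sigMat v N i) := by
  refine Matrix.ext_iff_mulVec.mpr fun x => funext fun f => ?_
  simp only [← Matrix.mulVec_mulVec, sigMat_mulVec, Function.comp_apply, sTr_lo, sTr_hi,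
    comp_sTr_sTr, Matrix.add_mulVec, Matrix.one_mulVec, Matrix.smul_mulVec, Pi.add_apply,
    Pi.smul_apply, eMat, Matrix.mulVec_diagonal, smul_eq_mul]
  rcases eq_or_ne (f (lo i)) (f (hi i)) with hab | hab
  · rw [comp_sTr_of_eq hab, hab, brCoeff_self, if_pos rfl]
    linear_combination x f * mul_inv_cancel₀ hv
  · rcases eq_or_ne (f (lo i)).1 (f (hi i)).1 with hc | hc
    · rw [if_pos hc]
      linear_combination x (f ∘ sTr i) * brCoeff_add_swap (v := v) hab hc +
        x f * brCoeff_sq (v := v) hab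
    · rw [if_neg hc, brCoeff_of_fst_ne hc, brCoeff_of_fst_ne hc.symm]
      ring

theorem eMat_commute_sigMat (i : Fin (n - 1)) : Commute (eMat K N i) (sigMat v N i) := by
  refine Matrix.ext_iff_mulVec.mpr fun x => funext fun f => ?_
  simp only [← Matrix.mulVec_mulVec, sigMat_mulVec, Function.comp_apply, sTr_lo, sTr_hi, eMat,
    Matrix.mulVec_diagonal, eq_comm (a := (f (hi i)).1)]
  ring

/-- The braiding generators as invertible matrices. -/
def sigUnit {v : K} (hv : v ≠ 0) (N : C → ℕ) (i : Fin (n - 1)) : (Mat K N n)ˣ where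
  val := sigMat v N i
  inv := sigMat v N i - (v - v⁻¹) • eMat K N i
  val_inv := by
    rw [mul_sub, sigMat_mul_self hv, mul_smul_comm, (eMat_commute_sigMat v i).eq,
      add_sub_cancel_right]
  inv_val := by rw [sub_mul, sigMat_mul_self hv, smul_mul_assoc, add_sub_cancel_right]

end Braiding

section Characters

variable {d : ℕ} [NeZero d]

theorem sum_range_natCast {M : Type*} [AddCommMonoid M] (φ : ZMod d → M) :
    ∑ s ∈ Finset.range d, φ (s : ZMod d) = ∑ s : ZMod d, φ s := by
  obtain ⟨k, rfl⟩ := Nat.exists_eq_succ_of_ne_zero (NeZero.ne d)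
  rw [Finset.sum_range]
  exact Finset.sum_congr rfl fun s _ => congrArg φ (Fin.cast_val_eq_self s)

theorem sum_Icc_natCast {M : Type*} [AddCommMonoid M] (φ : ZMod d → M) :
    ∑ s ∈ Finset.Icc 1 d, φ (s : ZMod d) = ∑ s : ZMod d, φ s := by
  rw [← sum_range_natCast, Finset.range_eq_Ico, ← Finset.Ico_add_one_right_eq_Icc,
    Finset.sum_Ico_succ_top NeZero.one_le, Finset.sum_eq_sum_Ico_succ_bot (NeZero.pos d),
    ZMod.natCast_self, Nat.cast_zero, add_comm]

theorem sum_stdAddChar_mul (k : ZMod d) :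
    ∑ s : ZMod d, ZMod.stdAddChar (s * k) = if k = 0 then (d : ℂ) else 0 := by
  rw [AddChar.sum_mulShift k (ZMod.isPrimitive_stdAddChar d), ZMod.card, Nat.cast_ite,
    Nat.cast_zero]

end Characters

section Representation

variable {d : ℕ} [NeZero d] {N : ZMod d → ℕ} {n : ℕ} {v : ℂ} (hv : v ≠ 0)

/-- The action of the powers of the `j`-th framing generator: on a vector of colour `k`, the
generator is multiplication by the root of unity `exp (2πik/d)`. -/
def framingHom (N : ZMod d → ℕ) (j : Fin n) : Multiplicative (ZMod d) →* Mat ℂ N n where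
  toFun s := Matrix.diagonal fun f => ZMod.stdAddChar (s.toAdd * (f j).1)
  map_one' := by simp
  map_mul' s s' := by
    rw [Matrix.diagonal_mul_diagonal]
    simp only [toAdd_mul, add_mul, AddChar.map_add_eq_mul]

theorem framingHom_apply (j : Fin n) (s : Multiplicative (ZMod d)) :
    framingHom N j s = Matrix.diagonal fun f => ZMod.stdAddChar (s.toAdd * (f j).1) := rfl

theorem framingHom_mul_sigMat (i : Fin (n - 1)) (j : Fin n) (s : Multiplicative (ZMod d)) :
    framingHom N j s * sigMat v N i = sigMat v N i * framingHom N (sTr i j) s := by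
  refine Matrix.ext_iff_mulVec.mpr fun x => funext fun f => ?_
  simp only [← Matrix.mulVec_mulVec, sigMat_mulVec, Function.comp_apply, framingHom_apply,
    Matrix.mulVec_diagonal, sTr_sTr]
  rcases eq_or_ne (f (lo i)).1 (f (hi i)).1 with hc | hc
  · have : (f (sTr i j)).1 = (f j).1 :=
      congrFun (comp_sTr_of_eq (f := fun k => (f k).1) hc) j
    rw [this]; ring
  · rw [brCoeff_of_fst_ne hc]; ring

/-- The representation of the framed braid group on the `n`-th tensor power. -/
def rep (N : ZMod d → ℕ) (n : ℕ) : FramedBraidGroup d n →* Mat ℂ N n :=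
  (Units.coeHom _).comp <| PresentedGroup.toGroup (f := Sum.elim (fun i => sigUnit hv N i)
    (fun j => (framingHom N j).toHomUnits (Multiplicative.ofAdd 1))) <| by
    rintro w (⟨i, j, h⟩ | ⟨i, j, h⟩ | ⟨i, j⟩ | ⟨i, j⟩ | ⟨j⟩) <;>
      simp only [fσ, ft, map_mul, map_inv, map_pow, FreeGroup.lift_apply_of, Sum.elim_inl,
        Sum.elim_inr, mul_inv_eq_one] <;> refine Units.ext ?_
    · exact sigMat_braid hv h
    · exact sigMat_comm v h
    · exact Matrix.commute_diagonal _ _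
    · exact framingHom_mul_sigMat i j _
    · rw [← map_pow, ← ofAdd_nsmul, nsmul_one, ZMod.natCast_self, ofAdd_zero, map_one]

theorem rep_σF (i : Fin (n - 1)) : rep hv N n (σF d i) = sigMat v N i := by
  rw [rep, MonoidHom.comp_apply, σF, PresentedGroup.toGroup.of]
  rfl

theorem rep_tF_zpow (j : Fin n) (s : ℤ) :
    rep hv N n (tF d j ^ s) = framingHom N j (Multiplicative.ofAdd (s : ZMod d)) := by
  rw [rep, MonoidHom.comp_apply, map_zpow, tF, PresentedGroup.toGroup.of, Sum.elim_inr, ← map_zpow,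
    ← ofAdd_zsmul, zsmul_one]
  rfl

theorem rep_tF_pow (j : Fin n) (s : ℕ) :
    rep hv N n (tF d j ^ s) = framingHom N j (Multiplicative.ofAdd (s : ZMod d)) := by
  simpa using rep_tF_zpow (N := N) hv j (s : ℤ)

theorem framingSum_rep (i : Fin (n - 1)) : framingSum (rep hv N n) i = (d : ℂ) • eMat ℂ N i := by
  have (s : ℕ) : rep hv N n (tF d (lo i) ^ s * (tF d (hi i) ^ s)⁻¹) =
      Matrix.diagonalAddMonoidHom _ ℂ fun f =>
        ZMod.stdAddChar ((s : ZMod d) * ((f (lo i)).1 - (f (hi i)).1)) := by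
    rw [← zpow_natCast, ← zpow_natCast, ← zpow_neg, map_mul, rep_tF_zpow, rep_tF_zpow,
      framingHom_apply, framingHom_apply, Matrix.diagonal_mul_diagonal,
      Matrix.diagonalAddMonoidHom_apply]
    simp only [← AddChar.map_add_eq_mul, toAdd_ofAdd, Int.cast_neg, Int.cast_natCast, neg_mul,
      ← sub_eq_add_neg, mul_sub]
  simp only [framingSum, this]
  rw [sum_Icc_natCast fun s : ZMod d => Matrix.diagonalAddMonoidHom (Fin n → Vec N) ℂ fun f =>
    ZMod.stdAddChar (s * ((f (lo i)).1 - (f (hi i)).1)), ← map_sum, eMat, ← Matrix.diagonal_smul]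
  refine congrArg Matrix.diagonal (funext fun f => ?_)
  simp [sum_stdAddChar_mul, sub_eq_zero]

end Representation

/-! ### The weighted trace -/

section Weights

variable {C K : Type*} [Field K] {N : C → ℕ} {n : ℕ} (v z : K)

/-- The weight of a basis vector. It decays geometrically within a colour, which makes the partial
weighted trace of the braiding the scalar `z` (`sum_wt_mul_brCoeff`). -/
def wt (a : Vec N) : K := z * v⁻¹ * (v⁻¹ ^ 2) ^ a.2.1

/-- The sum of the weights of the first `m` vectors of a colour. -/
def wtSum (m : ℕ) : K := ∑ r ∈ Finset.range m, z * v⁻¹ * (v⁻¹ ^ 2) ^ r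

/-- The weight of a basis tensor. -/
def wtTensor (f : Fin n → Vec N) : K := ∏ j, wt v z (f j)

theorem wtTensor_snoc (f : Fin n → Vec N) (a : Vec N) :
    wtTensor v z (Fin.snoc (α := fun _ => Vec N) f a) = wtTensor v z f * wt v z a := by
  simp [wtTensor, Fin.prod_univ_castSucc]

theorem wtTensor_comp_sTr (f : Fin n → Vec N) (i : Fin (n - 1)) :
    wtTensor v z (f ∘ sTr i) = wtTensor v z f :=
  Equiv.prod_comp (sTr i) fun j => wt v z (f j)

theorem sum_wt_mul [Fintype C] (φ : C → K) :
    ∑ a : Vec N, wt v z a * φ a.1 = ∑ k, wtSum v z (N k) * φ k := by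
  rw [Fintype.sum_sigma]
  refine Finset.sum_congr rfl fun k _ => ?_
  rw [wtSum, ← Fin.sum_univ_eq_sum_range, Finset.sum_mul]
  rfl

variable {v}

theorem mul_wtSum (hv : v ≠ 0) (m : ℕ) : (v - v⁻¹) * wtSum v z m = z * (1 - (v⁻¹ ^ 2) ^ m) := by
  induction m with
  | zero => simp [wtSum]
  | succ m ih =>
    rw [wtSum, Finset.sum_range_succ, ← wtSum, mul_add, ih]
    linear_combination z * (v⁻¹ ^ 2) ^ m * mul_inv_cancel₀ hv

theorem sum_range_wt_mul (hv : v ≠ 0) {i m : ℕ} (hi : i < m) :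
    ∑ r ∈ Finset.range m, z * v⁻¹ * (v⁻¹ ^ 2) ^ r *
      (if r < i then v - v⁻¹ else if r = i then v else 0) = z := by
  have below : ∑ r ∈ Finset.range i, z * v⁻¹ * (v⁻¹ ^ 2) ^ r *
      (if r < i then v - v⁻¹ else if r = i then v else 0) = (v - v⁻¹) * wtSum v z i := by
    rw [wtSum, Finset.mul_sum]
    refine Finset.sum_congr rfl fun r hr => ?_
    rw [if_pos (Finset.mem_range.1 hr), mul_comm]
  have above : ∑ r ∈ Finset.Ico (i + 1) m, z * v⁻¹ * (v⁻¹ ^ 2) ^ r *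
      (if r < i then v - v⁻¹ else if r = i then v else 0) = 0 := by
    refine Finset.sum_eq_zero fun r hr => ?_
    rw [Finset.mem_Ico] at hr
    rw [if_neg (by omega), if_neg (by omega), mul_zero]
  rw [← Finset.sum_range_add_sum_Ico _ (Nat.succ_le_of_lt hi), above, Finset.sum_range_succ,
    below, mul_wtSum z hv, if_neg (lt_irrefl _), if_pos rfl]
  linear_combination z * (v⁻¹ ^ 2) ^ i * mul_inv_cancel₀ hv

theorem sum_wt_mul_brCoeff [DecidableEq C] [Fintype C] (hv : v ≠ 0) (a : Vec N) :
    ∑ b : Vec N, wt v z b * (brCoeff v a b + if a = b then 1 else 0) = z := by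
  obtain ⟨k, i⟩ := a
  rw [Fintype.sum_sigma, Fintype.sum_eq_single k]
  · conv_rhs => rw [← sum_range_wt_mul z hv i.2, ← Fin.sum_univ_eq_sum_range (fun r => z * v⁻¹ *
      (v⁻¹ ^ 2) ^ r * if r < i.1 then v - v⁻¹ else if r = i.1 then v else 0)]
    refine Finset.sum_congr rfl fun j _ => congrArg _ ?_
    rcases lt_trichotomy j i with h | rfl | h
    · simp [brCoeff, h, h.ne']
    · simp [brCoeff]
    · simp [brCoeff, h.not_gt, h.ne, h.ne', Fin.val_inj]
  · intro l hl
    refine Finset.sum_eq_zero fun j _ => ?_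
    rw [brCoeff_of_fst_ne hl.symm, if_neg fun e => hl (congrArg Sigma.fst e).symm, add_zero,
      mul_zero]

end Weights

section WeightedTrace

variable {C K : Type*} [DecidableEq C] [Fintype C] [Field K] {N : C → ℕ} {n : ℕ}

/-- The weighted trace of an operator on a tensor power. -/
def wtTrace (v z : K) (N : C → ℕ) (n : ℕ) : Mat K N n →ₗ[K] K :=
  Matrix.traceLinearMap _ K K ∘ₗ LinearMap.mulLeft K (Matrix.diagonal (wtTensor v z))

theorem wtTrace_apply (v z : K) (M : Mat K N n) :
    wtTrace v z N n M = ∑ f, wtTensor v z f * M f f := by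
  simp [wtTrace, Matrix.trace]

theorem wtTrace_mul_comm {v z : K} {M M' : Mat K N n}
    (h : Commute (Matrix.diagonal (wtTensor v z)) M') :
    wtTrace v z N n (M * M') = wtTrace v z N n (M' * M) := by
  change (Matrix.diagonal (wtTensor v z) * (M * M')).trace =
    (Matrix.diagonal (wtTensor v z) * (M' * M)).trace
  rw [← mul_assoc, Matrix.trace_mul_comm, ← mul_assoc, ← mul_assoc, h.eq]

theorem wtTensor_commute_sigMat (v z : K) (i : Fin (n - 1)) :
    Commute (Matrix.diagonal (wtTensor v z)) (sigMat v N i) := by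
  refine Matrix.ext_iff_mulVec.mpr fun x => funext fun f => ?_
  simp only [← Matrix.mulVec_mulVec, sigMat_mulVec, Matrix.mulVec_diagonal, wtTensor_comp_sTr]
  ring

theorem sum_snoc {V M : Type*} [Fintype V] [AddCommMonoid M] (F : (Fin (n + 1) → V) → M) :
    ∑ f, F f = ∑ f : Fin n → V, ∑ a, F (Fin.snoc (α := fun _ => V) f a) := by
  rw [← Fintype.sum_prod_type', ← (Equiv.prodComm _ _).sum_comp,
    ← (Fin.snocEquiv fun _ => V).sum_comp]
  rfl

theorem eq_iff_init_last {V : Type*} {f g : Fin (n + 1) → V} :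
    f = g ↔ f (Fin.last n) = g (Fin.last n) ∧
      (Fin.init f : Fin n → V) = (Fin.init g : Fin n → V) := by
  refine ⟨fun h => h ▸ ⟨rfl, rfl⟩, fun ⟨h, h'⟩ => ?_⟩
  rw [← Fin.snoc_init_self f, ← Fin.snoc_init_self g, h, h']

/-- The inclusion `M ↦ M ⊗ 1` of the operators on the first `n` of `n + 1` tensor factors. -/
def inclMat (K : Type*) [Field K] (N : C → ℕ) (n : ℕ) : Mat K N n →ₐ[K] Mat K N (n + 1) :=
  (Matrix.reindexAlgEquiv K K
    ((Equiv.prodComm _ _).trans (Fin.snocEquiv fun _ => Vec N))).toAlgHom.comp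
    { (Matrix.blockDiagonalRingHom (Fin n → Vec N) (Vec N) K).comp (Pi.constRingHom _ _) with
      commutes' c := by
        change Matrix.blockDiagonal (fun _ => algebraMap K _ c) = _
        simp only [Matrix.algebraMap_eq_diagonal, Matrix.blockDiagonal_diagonal]
        rfl }

theorem inclMat_apply (M : Mat K N n) (f f' : Fin (n + 1) → Vec N) : inclMat K N n M f f' =
    if f (Fin.last n) = f' (Fin.last n) then M (Fin.init f) (Fin.init f') else 0 := rfl

theorem inclMat_diagonal (φ : (Fin n → Vec N) → K) :
    inclMat K N n (Matrix.diagonal φ) = Matrix.diagonal fun f => φ (Fin.init f) := by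
  ext f f'
  simp only [inclMat_apply, Matrix.diagonal_apply, eq_iff_init_last (f := f), ite_and]

theorem inclMat_sigMat (v : K) (i : Fin (n - 1)) :
    inclMat K N n (sigMat v N i) = sigMat v N (n := n + 1) (up i) := by
  ext f f'
  have init_comp : (Fin.init (f ∘ sTr (up i)) : Fin n → Vec N) = Fin.init f ∘ sTr i := by
    funext j
    simp only [Fin.init, Function.comp_apply, sTr_up]
  simp only [inclMat_apply, sigMat, Matrix.of_apply, eq_iff_init_last (n := n) (f := f),
    eq_iff_init_last (n := n) (f := f ∘ sTr (up i)), init_comp, Function.comp_apply, sTr_up_last,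
    ite_and]
  split_ifs <;> first | rfl | exact (add_zero 0).symm

theorem wtTrace_inclMat_mul_diagonal (v z : K) (M : Mat K N n) (φ : C → K) :
    wtTrace v z N (n + 1) (inclMat K N n M * Matrix.diagonal fun f => φ (f (Fin.last n)).1) =
      (∑ k, wtSum v z (N k) * φ k) * wtTrace v z N n M := by
  rw [← sum_wt_mul, wtTrace_apply, wtTrace_apply, sum_snoc, Finset.sum_mul_sum, Finset.sum_comm]
  refine Finset.sum_congr rfl fun a _ => Finset.sum_congr rfl fun f _ => ?_
  rw [Matrix.mul_diagonal, inclMat_apply, if_pos rfl, wtTensor_snoc, Fin.snoc_last, Fin.init_snoc]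
  ring

theorem snoc_lo_top {V : Type*} (f : Fin (n + 1) → V) (a : V) :
    (Fin.snoc (α := fun _ => V) f a : Fin (n + 2) → V) (lo (n := n + 2) (top n)) =
      f (Fin.last n) :=
  Fin.snoc_castSucc (α := fun _ => V) (n := n + 1) a f (Fin.last n)

theorem snoc_hi_top {V : Type*} (f : Fin (n + 1) → V) (a : V) :
    (Fin.snoc (α := fun _ => V) f a : Fin (n + 2) → V) (hi (n := n + 2) (top n)) = a :=
  Fin.snoc_last (α := fun _ => V) a f

theorem inclMat_mul_sigMat_top_snoc (v : K) (M : Mat K N (n + 1)) (f : Fin (n + 1) → Vec N)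
    (a : Vec N) :
    (inclMat K N (n + 1) M * sigMat v N (n := n + 2) (top n))
      (Fin.snoc (α := fun _ => Vec N) f a) (Fin.snoc (α := fun _ => Vec N) f a) =
      (brCoeff v (f (Fin.last n)) a + if f (Fin.last n) = a then 1 else 0) * M f f := by
  set fa : Fin (n + 2) → Vec N := Fin.snoc (α := fun _ => Vec N) f a
  have lo_top : fa (lo (n := n + 2) (top n)) = f (Fin.last n) := snoc_lo_top f a
  have hi_top : fa (hi (n := n + 2) (top n)) = a := snoc_hi_top f a
  have swap_last : (fa ∘ sTr (n := n + 2) (top n)) (Fin.last (n + 1)) = f (Fin.last n) :=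
    (congrArg fa (sTr_hi (n := n + 2) (top n))).trans lo_top
  have init_fa : (Fin.init fa : Fin (n + 1) → Vec N) = f := Fin.init_snoc (α := fun _ => Vec N) a f
  have last_fa : fa (Fin.last (n + 1)) = a := hi_top
  rw [mul_sigMat, inclMat_apply, inclMat_apply, if_pos rfl, lo_top, hi_top, swap_last, init_fa,
    last_fa]
  rcases eq_or_ne (f (Fin.last n)) a with h | h
  · rw [comp_sTr_of_eq (f := fa) (by rw [lo_top, hi_top, h]), init_fa, if_pos h, if_pos h.symm]
    ring
  · rw [if_neg h, if_neg h.symm]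
    ring

theorem wtTrace_inclMat_mul_sigMat_top {v : K} (hv : v ≠ 0) (z : K) (M : Mat K N (n + 1)) :
    wtTrace v z N (n + 2) (inclMat K N (n + 1) M * sigMat v N (n := n + 2) (top n)) =
      z * wtTrace v z N (n + 1) M := by
  rw [wtTrace_apply, wtTrace_apply, sum_snoc, Finset.mul_sum]
  refine Finset.sum_congr rfl fun f _ => ?_
  conv_rhs => lhs; rw [← sum_wt_mul_brCoeff z hv (f (Fin.last n))]
  rw [Finset.sum_mul]
  refine Finset.sum_congr rfl fun a _ => ?_
  rw [inclMat_mul_sigMat_top_snoc, wtTensor_snoc]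
  ring

end WeightedTrace

section WeightedTraceOfRepresentation

variable {d : ℕ} [NeZero d] {N : ZMod d → ℕ} {n : ℕ} {v : ℂ} (hv : v ≠ 0) (z : ℂ)

theorem wtTensor_commute_rep (w : FramedBraidGroup d n) :
    Commute (Matrix.diagonal (wtTensor v z)) (rep hv N n w) := by
  refine commute_of_generators (fun i => ?_) (fun j => ?_) w
  · exact rep_σF (N := N) hv i ▸ wtTensor_commute_sigMat v z i
  · rw [← pow_one (tF d j), rep_tF_pow]
    exact Matrix.commute_diagonal _ _

theorem inclMat_rep (w : FramedBraidGroup d n) :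
    inclMat ℂ N n (rep hv N n w) = rep hv N (n + 1) (inclF d n w) := by
  refine DFunLike.congr_fun (framedHom_ext (φ := (inclMat ℂ N n : _ →* _).comp (rep hv N n))
    (ψ := (rep hv N (n + 1)).comp (inclF d n)) (fun i => ?_) fun j => ?_) w
  · change inclMat ℂ N n (rep hv N n (σF d i)) = rep hv N (n + 1) (inclF d n (σF d i))
    rw [inclF_σF, rep_σF, rep_σF, inclMat_sigMat]
  · change inclMat ℂ N n (rep hv N n (tF d j)) = rep hv N (n + 1) (inclF d n (tF d j))
    rw [inclF_tF, ← pow_one (tF d j), rep_tF_pow, ← pow_one (tF d j.castSucc), rep_tF_pow,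
      framingHom_apply, inclMat_diagonal]
    rfl

theorem wtTrace_inclMat_mul_rep_tF_pow (M : Mat ℂ N n) (s : ℕ) :
    wtTrace v z N (n + 1) (inclMat ℂ N n M * rep hv N (n + 1) (tF d (Fin.last n) ^ s)) =
      (∑ k, wtSum v z (N k) * ZMod.stdAddChar ((s : ZMod d) * k)) * wtTrace v z N n M := by
  rw [rep_tF_pow, framingHom_apply]
  exact wtTrace_inclMat_mul_diagonal v z M fun k => ZMod.stdAddChar ((s : ZMod d) * k)

end WeightedTraceOfRepresentation

/-! ### Polynomiality of the weighted traces -/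

section PartialEvaluation

variable {σ R : Type*} [CommRing R]

/-- The evaluation of the variable `none` at `c`. -/
def evalNone (c : R) : MvPolynomial (Option σ) R →ₐ[R] MvPolynomial σ R :=
  MvPolynomial.aeval fun o => o.elim (MvPolynomial.C c) MvPolynomial.X

theorem eval_evalNone (c : R) (y : σ → R) (P : MvPolynomial (Option σ) R) :
    MvPolynomial.eval y (evalNone c P) = MvPolynomial.eval (fun o => o.elim c y) P := by
  have : (MvPolynomial.aeval y).comp (evalNone c) =
      (MvPolynomial.aeval fun o => o.elim c y : MvPolynomial (Option σ) R →ₐ[R] R) :=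
    MvPolynomial.algHom_ext fun o => by cases o <;> simp [evalNone]
  exact DFunLike.congr_fun this P

theorem eval_optionEquivLeft (c : R) (P : MvPolynomial (Option σ) R) :
    Polynomial.eval (MvPolynomial.C c) (MvPolynomial.optionEquivLeft R σ P) = evalNone c P := by
  have : ((Polynomial.aeval (MvPolynomial.C c)).restrictScalars R).comp
      (MvPolynomial.optionEquivLeft R σ).toAlgHom = evalNone c :=
    MvPolynomial.algHom_ext fun o => by cases o <;> simp [evalNone]
  exact DFunLike.congr_fun this P

theorem eq_of_evalNone_eq [IsDomain R] {S : Set R} (hS : S.Infinite)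
    {P Q : MvPolynomial (Option σ) R} (h : ∀ c ∈ S, evalNone c P = evalNone c Q) : P = Q := by
  refine (MvPolynomial.optionEquivLeft R σ).injective (Polynomial.eq_of_infinite_eval_eq _ _
    ((hS.image (MvPolynomial.C_injective σ R).injOn).mono ?_))
  rintro _ ⟨c, hc, rfl⟩
  exact (eval_optionEquivLeft c P).trans ((h c hc).trans (eval_optionEquivLeft c Q).symm)

end PartialEvaluation

section GenericParameters

theorem wtSum_injective {m : ℕ} {z : ℂ} (hz : z ≠ 0) :
    Function.Injective (wtSum ((m + 2 : ℕ) : ℂ) z) := by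
  intro a b hab
  have hv : ((m + 2 : ℕ) : ℂ) ≠ 0 := NeZero.ne _
  have h := mul_wtSum z hv a
  rw [hab, mul_wtSum z hv b] at h
  have pow_eq : (((m + 2 : ℕ) : ℂ) ^ 2) ^ a = (((m + 2 : ℕ) : ℂ) ^ 2) ^ b := by
    rw [← inv_inj, ← inv_pow, ← inv_pow, ← inv_pow, ← inv_pow]
    linear_combination mul_left_cancel₀ hz h
  have two_le : 2 ≤ (m + 2) ^ 2 := by nlinarith [Nat.zero_le m]
  exact Nat.pow_right_injective two_le (by exact_mod_cast pow_eq)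

theorem sub_inv_injective :
    Function.Injective fun m : ℕ => ((m + 2 : ℕ) : ℂ) - ((m + 2 : ℕ) : ℂ)⁻¹ := by
  intro a b (hab : ((a + 2 : ℕ) : ℂ) - ((a + 2 : ℕ) : ℂ)⁻¹ = ((b + 2 : ℕ) : ℂ) - _)
  have ha : ((a + 2 : ℕ) : ℂ) ≠ 0 := NeZero.ne _
  have hb : ((b + 2 : ℕ) : ℂ) ≠ 0 := NeZero.ne _
  have h : (((a + 2 : ℕ) : ℂ) - ((b + 2 : ℕ) : ℂ)) *
      (((a + 2 : ℕ) : ℂ) * ((b + 2 : ℕ) : ℂ) + 1) = 0 := by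
    field_simp at hab
    linear_combination hab
  rcases mul_eq_zero.1 h with h | h
  · have : a + 2 = b + 2 := by exact_mod_cast sub_eq_zero.1 h
    omega
  · exact absurd h (by norm_cast)

/-- The parameters of a tensor representation with a weighted trace: the eigenvalue `v` of the
braiding, the Markov parameter `z` and the number `N k` of basis vectors of each colour `k`. -/
structure Param (d : ℕ) where
  v : ℂ
  hv : v ≠ 0
  z : ℂ
  N : ZMod d → ℕ

/-- The ring of generic parameters: `none` stands for `q - q⁻¹`, `some none` for `z` and
`some (some k)` for the total weight of the colour `k`. -/
abbrev GenRing (d : ℕ) : Type := MvPolynomial (Option (Option (ZMod d))) ℂ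

variable {d : ℕ}

/-- The values of the generic parameters. -/
def Param.val (p : Param d) (o : Option (Option (ZMod d))) : ℂ :=
  o.elim (p.v - p.v⁻¹) fun o' => o'.elim p.z fun k => wtSum p.v p.z (p.N k)

theorem eq_of_eval_val {P Q : GenRing d}
    (h : ∀ p : Param d, MvPolynomial.eval p.val P = MvPolynomial.eval p.val Q) : P = Q := by
  refine eq_of_evalNone_eq (Set.infinite_range_of_injective sub_inv_injective) ?_
  rintro _ ⟨m, rfl⟩
  refine eq_of_evalNone_eq (Set.finite_singleton (0 : ℂ)).infinite_compl fun z hz => ?_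
  refine MvPolynomial.funext_set (fun _ => Set.range (wtSum ((m + 2 : ℕ) : ℂ) z))
    (fun _ => Set.infinite_range_of_injective (wtSum_injective hz)) fun y hy => ?_
  choose N hN using fun k => hy k (Set.mem_univ k)
  obtain rfl : (fun k => wtSum ((m + 2 : ℕ) : ℂ) z (N k)) = y := funext hN
  simp only [eval_evalNone]
  exact h ⟨((m + 2 : ℕ) : ℂ), NeZero.ne _, z, N⟩

/-- The operators on the `n`-th tensor power for the parameters `p`, as an algebra over the ring of
generic parameters. -/
def ParamMat (p : Param d) (n : ℕ) : Type := Mat ℂ p.N n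

variable [NeZero d]

instance (p : Param d) (n : ℕ) : Ring (ParamMat p n) := inferInstanceAs (Ring (Mat ℂ p.N n))

instance (p : Param d) (n : ℕ) : Algebra ℂ (ParamMat p n) :=
  inferInstanceAs (Algebra ℂ (Mat ℂ p.N n))

instance (p : Param d) (n : ℕ) : Algebra (GenRing d) (ParamMat p n) :=
  Algebra.compHom _ (MvPolynomial.eval p.val)

namespace Param

variable (p : Param d) {n : ℕ}

theorem smul_def (P : GenRing d) (M : ParamMat p n) : P • M = MvPolynomial.eval p.val P • M := rfl

/-- The representation of the framed braid group for the parameters `p`. -/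
def rep (n : ℕ) : FramedBraidGroup d n →* ParamMat p n := YH.rep p.hv p.N n

/-- The inclusion of the operators on `n` tensor factors. -/
def incl (n : ℕ) : ParamMat p n →ₐ[GenRing d] ParamMat p (n + 1) where
  toRingHom := (inclMat ℂ p.N n).toRingHom
  commutes' P := (inclMat ℂ p.N n).commutes (MvPolynomial.eval p.val P)

/-- The weighted trace for the parameters `p`. -/
def trace (n : ℕ) : ParamMat p n →ₗ[ℂ] ℂ := wtTrace p.v p.z p.N n

theorem incl_rep (w : FramedBraidGroup d n) :
    p.incl n (p.rep n w) = p.rep (n + 1) (inclF d n w) := inclMat_rep p.hv w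

theorem rep_quad (i : Fin (n - 1)) : p.rep n (σF d i) * p.rep n (σF d i) =
    1 + (MvPolynomial.C (1 / (d : ℂ)) * MvPolynomial.X none : GenRing d) •
      (framingSum (p.rep n) i * p.rep n (σF d i)) := by
  have hd : (d : ℂ) ≠ 0 := NeZero.ne _
  have hcoeff : MvPolynomial.eval p.val (MvPolynomial.C (1 / (d : ℂ)) * MvPolynomial.X none) * d =
      p.v - p.v⁻¹ := by
    rw [map_mul, MvPolynomial.eval_C, MvPolynomial.eval_X, val, Option.elim_none]
    field_simp
  rw [smul_def]
  change YH.rep p.hv p.N n (σF d i) * YH.rep p.hv p.N n (σF d i) =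
    1 + MvPolynomial.eval p.val _ •
      (framingSum (YH.rep p.hv p.N n) i * YH.rep p.hv p.N n (σF d i))
  rw [framingSum_rep, rep_σF, smul_mul_assoc, smul_smul, hcoeff, sigMat_mul_self p.hv]

theorem trace_zero_one : p.trace 0 1 = 1 := by
  change wtTrace p.v p.z p.N 0 1 = 1
  simp [wtTrace_apply, wtTensor]

theorem trace_mul_comm (M : ParamMat p n) (w : FramedBraidGroup d n) :
    p.trace n (M * p.rep n w) = p.trace n (p.rep n w * M) :=
  wtTrace_mul_comm (wtTensor_commute_rep p.hv p.z w)

theorem trace_incl_mul_tF_pow (M : ParamMat p n) (s : ℕ) :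
    p.trace (n + 1) (p.incl n M * p.rep (n + 1) (tF d (Fin.last n) ^ s)) =
      MvPolynomial.eval p.val (∑ k, MvPolynomial.X (some (some k)) *
        MvPolynomial.C (ZMod.stdAddChar ((s : ZMod d) * k))) * p.trace n M := by
  refine (wtTrace_inclMat_mul_rep_tF_pow p.hv p.z M s).trans ?_
  simp only [map_sum, map_mul, MvPolynomial.eval_X, MvPolynomial.eval_C]
  rfl

theorem trace_incl_mul_σF_top (M : ParamMat p (n + 1)) :
    p.trace (n + 2) (p.incl (n + 1) M * p.rep (n + 2) (σF d (top n))) =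
      MvPolynomial.eval p.val (MvPolynomial.X (some none)) * p.trace (n + 1) M := by
  rw [MvPolynomial.eval_X]
  have hσ : p.rep (n + 2) (σF d (top n)) = sigMat p.v p.N (n := n + 2) (top n) := rep_σF p.hv _
  rw [hσ]
  exact wtTrace_inclMat_mul_sigMat_top p.hv p.z M

end Param

end GenericParameters

section Polynomiality

variable (d : ℕ) [NeZero d] {n : ℕ}

/-- The tower of the tensor representations, for all values of the parameters at once. -/
def repTower : Tower (GenRing d) d (MvPolynomial.C (1 / (d : ℂ)) * MvPolynomial.X none)
    (fun n => ∀ p : Param d, ParamMat p n) where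
  ρ n := MonoidHom.pi fun p => p.rep n
  ι n := AlgHom.pi fun p => (p.incl n).comp (Pi.evalAlgHom _ _ p)
  ι_ρ _ w := funext fun p => p.incl_rep w
  quad n i := funext fun p => by
    have hsum : framingSum (MonoidHom.pi fun p : Param d => p.rep n :
        FramedBraidGroup d n →* ∀ p : Param d, ParamMat p n) i p =
        framingSum (p.rep n) i := by
      simp only [framingSum, Finset.sum_apply]
      rfl
    rw [Pi.add_apply, Pi.smul_apply, Pi.mul_apply, Pi.mul_apply, hsum]
    exact p.rep_quad i

/-- The families of operators whose weighted trace is a polynomial in the generic parameters. -/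
def polyMats (n : ℕ) : Submodule (GenRing d) (∀ p : Param d, ParamMat p n) where
  carrier := {M | ∃ P : GenRing d, ∀ p : Param d, p.trace n (M p) = MvPolynomial.eval p.val P}
  zero_mem' := ⟨0, fun p => by rw [map_zero]; exact map_zero (p.trace n)⟩
  add_mem' := by
    rintro M M' ⟨P, hP⟩ ⟨P', hP'⟩
    exact ⟨P + P', fun p => by rw [map_add, ← hP, ← hP']; exact map_add (p.trace n) _ _⟩
  smul_mem' := by
    rintro Q M ⟨P, hP⟩
    exact ⟨Q * P, fun p => by
      rw [map_mul, ← hP, Pi.smul_apply, Param.smul_def, map_smul, smul_eq_mul]⟩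

variable {d}

theorem repTower_ι_apply (M : ∀ p : Param d, ParamMat p n) (p : Param d) :
    (repTower d).ι n M p = p.incl n (M p) := rfl

theorem repTower_t_pow_apply (s : ℕ) (p : Param d) :
    ((repTower d).t n ^ s) p = p.rep (n + 1) (tF d (Fin.last n) ^ s) :=
  (map_pow (p.rep (n + 1)) _ s).symm

theorem repTower_g_apply (p : Param d) :
    (repTower d).g n p = p.rep (n + 2) (σF d (top n)) := rfl

theorem trace_mul_comm_of_mem_image (M : ∀ p : Param d, ParamMat p n)
    {M' : ∀ p : Param d, ParamMat p n} (hM' : M' ∈ (repTower d).image n) (p : Param d) :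
    p.trace n (M p * M' p) = p.trace n (M' p * M p) := by
  replace hM' := ((repTower d).image_toSubmodule_eq_span (n := n)).le hM'
  induction hM' using Submodule.span_induction with
  | mem x hx =>
    obtain ⟨w, rfl⟩ := hx
    exact p.trace_mul_comm (M p) w
  | zero => rw [Pi.zero_apply, mul_zero, zero_mul]
  | add x y _ _ hx hy => rw [Pi.add_apply, mul_add, add_mul, map_add, map_add, hx, hy]
  | smul P x _ hx =>
    rw [Pi.smul_apply, Param.smul_def, mul_smul_comm, smul_mul_assoc, map_smul, map_smul, hx]

theorem ι_mul_t_pow_mem_polyMats {M : ∀ p : Param d, ParamMat p n} (hM : M ∈ polyMats d n)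
    (s : ℕ) : (repTower d).ι n M * (repTower d).t n ^ s ∈ polyMats d (n + 1) := by
  obtain ⟨P, hP⟩ := hM
  refine ⟨(∑ k, MvPolynomial.X (some (some k)) *
    MvPolynomial.C (ZMod.stdAddChar ((s : ZMod d) * k))) * P, fun p => ?_⟩
  rw [Pi.mul_apply, repTower_ι_apply, repTower_t_pow_apply, p.trace_incl_mul_tF_pow, hP,
    map_mul (MvPolynomial.eval _)]

theorem ι_mul_g_mul_ι_mem_polyMats {M M' : ∀ p : Param d, ParamMat p (n + 1)}
    (hM' : M' ∈ (repTower d).image (n + 1)) (h : M' * M ∈ polyMats d (n + 1)) :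
    (repTower d).ι (n + 1) M * (repTower d).g n * (repTower d).ι (n + 1) M' ∈
      polyMats d (n + 2) := by
  obtain ⟨P, hP⟩ := h
  refine ⟨MvPolynomial.X (some none) * P, fun p => ?_⟩
  rw [Pi.mul_apply, trace_mul_comm_of_mem_image _ ((repTower d).ι_mem hM') p, ← Pi.mul_apply,
    ← mul_assoc, ← map_mul, Pi.mul_apply, repTower_ι_apply, repTower_g_apply,
    p.trace_incl_mul_σF_top, hP, map_mul (MvPolynomial.eval _)]

theorem image_le_polyMats (n : ℕ) :
    Subalgebra.toSubmodule ((repTower d).image n) ≤ polyMats d n := by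
  induction n with
  | zero =>
    refine ((repTower d).image_toSubmodule_eq_span (n := 0)).le.trans (Submodule.span_le.2 ?_)
    rintro _ ⟨w, rfl⟩
    rw [framed_zero_eq_one w, map_one]
    exact ⟨1, fun p => p.trace_zero_one.trans (map_one _).symm⟩
  | succ n ih =>
    refine ((repTower d).image_le_stdSpan n).trans (Submodule.span_le.2 ?_)
    rintro _ (⟨ha, s⟩ | ⟨ha, hb⟩)
    · exact ι_mul_t_pow_mem_polyMats (ih ha) s
    · exact ι_mul_g_mul_ι_mem_polyMats hb (ih (((repTower d).image _).mul_mem hb ha))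

/-- The polynomial in the generic parameters whose values are the weighted traces of a framed
braid. -/
def genTrace (w : FramedBraidGroup d n) : GenRing d :=
  (image_le_polyMats n ((repTower d).ρ_mem w)).choose

theorem eval_genTrace (w : FramedBraidGroup d n) (p : Param d) :
    MvPolynomial.eval p.val (genTrace w) = p.trace n (p.rep n w) :=
  ((image_le_polyMats n ((repTower d).ρ_mem w)).choose_spec p).symm

theorem genTrace_mul_comm (u w : FramedBraidGroup d n) : genTrace (u * w) = genTrace (w * u) := by
  refine eq_of_eval_val fun p => ?_
  rw [eval_genTrace, eval_genTrace, map_mul (p.rep n), map_mul (p.rep n), p.trace_mul_comm]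

theorem genTrace_zero (w : FramedBraidGroup d 0) : genTrace w = 1 := by
  refine eq_of_eval_val fun p => ?_
  rw [eval_genTrace, framed_zero_eq_one w, map_one (p.rep 0), map_one (MvPolynomial.eval _),
    p.trace_zero_one]

theorem genTrace_inclF_mul_tF_pow (w : FramedBraidGroup d n) (s : ℕ) :
    genTrace (inclF d n w * tF d (Fin.last n) ^ s) =
      (∑ k, MvPolynomial.X (some (some k)) *
        MvPolynomial.C (ZMod.stdAddChar ((s : ZMod d) * k))) * genTrace w := by
  refine eq_of_eval_val fun p => ?_
  rw [eval_genTrace, map_mul (p.rep _), ← p.incl_rep, p.trace_incl_mul_tF_pow,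
    map_mul (MvPolynomial.eval _), eval_genTrace]

theorem genTrace_inclF_mul_σF_top (w : FramedBraidGroup d (n + 1)) :
    genTrace (inclF d (n + 1) w * σF d (n := n + 2) (top n)) =
      MvPolynomial.X (some none) * genTrace w := by
  refine eq_of_eval_val fun p => ?_
  rw [eval_genTrace, map_mul (p.rep _), ← p.incl_rep, p.trace_incl_mul_σF_top,
    map_mul (MvPolynomial.eval _), eval_genTrace]

theorem genTrace_quad (u w : FramedBraidGroup d n) (i : Fin (n - 1)) :
    genTrace (u * (σF d i * σF d i) * w) = genTrace (u * w) +
      MvPolynomial.C (1 / (d : ℂ)) * MvPolynomial.X none * ∑ s ∈ Finset.Icc 1 d,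
        genTrace (u * (tF d (lo i) ^ s * (tF d (hi i) ^ s)⁻¹ * σF d i) * w) := by
  refine eq_of_eval_val fun p => ?_
  simp only [map_add, map_mul (MvPolynomial.eval _), map_sum, eval_genTrace]
  simp only [map_mul (p.rep n) _ w, map_mul (p.rep n) u, map_mul (p.rep n) _ (σF d i)]
  rw [p.rep_quad, Param.smul_def, mul_add, add_mul, mul_one, map_add, mul_smul_comm,
    smul_mul_assoc, map_smul, smul_eq_mul, map_mul (MvPolynomial.eval _), framingSum,
    Finset.sum_mul, Finset.mul_sum, Finset.sum_mul, map_sum]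

end Polynomiality

/-! ### Existence of the Juyumaya trace -/

section YokonumaHeckeTower

variable {d n : ℕ} {q : ℂ}

theorem framedToY_apply (w : FramedBraidGroup d n) :
    framedToY d n q w = toY d n q (MonoidAlgebra.of ℂ _ w) := rfl

theorem toY_surjective : Function.Surjective (toY d n q) :=
  RingQuot.mkAlgHom_surjective ℂ _

theorem Y_induction {P : Y d n q → Prop} (framed : ∀ w, P (framedToY d n q w))
    (add : ∀ a b, P a → P b → P (a + b)) (smul : ∀ (c : ℂ) a, P a → P (c • a)) (a : Y d n q) :
    P a := by
  obtain ⟨a, rfl⟩ := toY_surjective a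
  induction a using MonoidAlgebra.induction_on with
  | of w => exact framed w
  | add a b ha hb => rw [map_add]; exact add _ _ ha hb
  | smul c a ha => rw [map_smul]; exact smul _ _ ha

theorem incl_framedToY (w : FramedBraidGroup d n) :
    incl d n q (framedToY d n q w) = framedToY d (n + 1) q (inclF d n w) :=
  (RingQuot.liftAlgHom_mkAlgHom_apply ℂ _ _ _).trans (congrArg _ (inclA_of d n w))

theorem framedToY_quad (i : Fin (n - 1)) :
    framedToY d n q (σF d i) * framedToY d n q (σF d i) = 1 + (1 / (d : ℂ) * (q - q⁻¹)) •
      (framingSum (framedToY d n q) i * framedToY d n q (σF d i)) := by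
  have quad := RingQuot.mkAlgHom_rel ℂ (QuadRel.quad (d := d) (n := n) (q := q) i)
  change toY d n q _ = toY d n q _ at quad
  rw [map_pow, sq, map_add, map_one, map_smul, map_mul, eF, map_smul, map_sum] at quad
  rw [framedToY_apply, quad, smul_mul_assoc, smul_smul, mul_comm (q - q⁻¹)]
  rfl

variable (d q)

/-- The Yokonuma–Hecke algebras as a tower. -/
def yTower : Tower ℂ d (1 / (d : ℂ) * (q - q⁻¹)) (fun n => Y d n q) where
  ρ n := framedToY d n q
  ι n := incl d n q
  ι_ρ _ := incl_framedToY
  quad _ := framedToY_quad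

theorem yTower_image (n : ℕ) : (yTower d q).image n = ⊤ := by
  refine Algebra.eq_top_iff.2 fun a => ?_
  induction a using Y_induction with
  | framed w => exact (yTower d q).ρ_mem w
  | add a b ha hb => exact add_mem ha hb
  | smul c a ha => exact Subalgebra.smul_mem _ ha c

end YokonumaHeckeTower

section RingQuot

variable {S A M : Type*} [CommRing S] [Ring A] [Algebra S A] [AddCommGroup M] [Module S M]

/-- The congruence of the elements that a linear form does not distinguish in any product. -/
def contextCon (f : A →ₗ[S] M) : RingCon A where
  r x y := ∀ a b, f (a * x * b) = f (a * y * b)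
  iseqv := ⟨fun _ _ _ => rfl, fun h a b => (h a b).symm,
    fun h h' a b => (h a b).trans (h' a b)⟩
  add' h h' a b := by simp only [mul_add, add_mul, map_add, h a b, h' a b]
  mul' {x y x' y'} h h' a b := by
    calc f (a * (x * x') * b) = f (a * x * (x' * b)) := by simp only [mul_assoc]
      _ = f (a * y * (x' * b)) := h _ _
      _ = f (a * y * x' * b) := by simp only [mul_assoc]
      _ = f (a * y * y' * b) := h' _ _
      _ = f (a * (y * y') * b) := by simp only [mul_assoc]

theorem ker_mkAlgHom_le {r : A → A → Prop} {f : A →ₗ[S] M}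
    (hf : ∀ x y, r x y → contextCon f x y) :
    LinearMap.ker (RingQuot.mkAlgHom S r).toLinearMap ≤ LinearMap.ker f := by
  intro u hu
  have mk_eq : RingQuot.mkRingHom r u = RingQuot.mkRingHom r 0 := by
    rw [← RingQuot.mkAlgHom_coe S r, map_zero]
    exact hu
  have respects : ∀ ⦃x y⦄, r x y → (contextCon f).mk' x = (contextCon f).mk' y :=
    fun x y h => (RingCon.eq _).2 (hf x y h)
  have mk'_eq : (contextCon f).mk' u = (contextCon f).mk' 0 := by
    rw [← RingQuot.lift_mkRingHom_apply _ respects, mk_eq, RingQuot.lift_mkRingHom_apply]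
  have context_eq := (RingCon.eq _).1 mk'_eq 1 1
  rwa [one_mul, mul_one, mul_zero, zero_mul, map_zero] at context_eq

end RingQuot

theorem IsMarkovTrace.map {R R' : Type} [CommRing R] [Algebra ℂ R] [CommRing R'] [Algebra ℂ R']
    {d : ℕ} {q : ℂ} {z : R} {x : ZMod d → R} {tr : (n : ℕ) → Y d n q →ₗ[ℂ] R}
    (h : IsMarkovTrace d q z x tr) (φ : R →ₐ[ℂ] R') :
    IsMarkovTrace d q (φ z) (fun s => φ (x s)) (fun n => φ.toLinearMap ∘ₗ tr n) where
  compat n a := congrArg φ (h.compat n a)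
  comm n a b := congrArg φ (h.comm n a b)
  one n := (congrArg φ (h.one n)).trans (map_one φ)
  markov n a := (congrArg φ (h.markov n a)).trans (map_mul φ _ _)
  framing n a s hs hs' := (congrArg φ (h.framing n a s hs hs')).trans (map_mul φ _ _)

section Existence

variable (d : ℕ) [NeZero d] (q : ℂ)

/-- The specialization of the generic parameters: the total weight of the colour `k` becomes the
`k`-th Fourier coefficient of the indeterminates `x_s`. -/
def specGen : GenRing d →ₐ[ℂ] TraceRing d := MvPolynomial.aeval fun o =>
  o.elim (MvPolynomial.C (q - q⁻¹)) fun o' => o'.elim (MvPolynomial.X none) fun k =>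
    MvPolynomial.C (1 / (d : ℂ)) *
      ∑ s : ZMod d, xVar d s * MvPolynomial.C (ZMod.stdAddChar (-(s * k)))

theorem specGen_coeff : specGen d q (MvPolynomial.C (1 / (d : ℂ)) * MvPolynomial.X none) =
    algebraMap ℂ (TraceRing d) (1 / (d : ℂ) * (q - q⁻¹)) := by
  rw [map_mul, map_mul, specGen, MvPolynomial.aeval_X, MvPolynomial.algHom_C]
  rfl

theorem specGen_X_mul_C_stdAddChar (s k : ZMod d) :
    specGen d q (MvPolynomial.X (some (some k)) * MvPolynomial.C (ZMod.stdAddChar (s * k))) =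
      ∑ s' : ZMod d, MvPolynomial.C (1 / (d : ℂ)) *
        (xVar d s' * MvPolynomial.C (ZMod.stdAddChar (k * (s - s')))) := by
  rw [map_mul, specGen, MvPolynomial.aeval_X, MvPolynomial.algHom_C, Option.elim_some,
    Option.elim_some, Finset.mul_sum, Finset.sum_mul]
  refine Finset.sum_congr rfl fun s' _ => ?_
  rw [MvPolynomial.algebraMap_eq, mul_assoc, mul_assoc, ← map_mul, ← AddChar.map_add_eq_mul,
    show -(s' * k) + s * k = k * (s - s') by ring]

theorem specGen_sum (s : ZMod d) :
    specGen d q (∑ k, MvPolynomial.X (some (some k)) *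
      MvPolynomial.C (ZMod.stdAddChar (s * k))) = xVar d s := by
  have hd : (d : ℂ) ≠ 0 := NeZero.ne _
  simp only [map_sum (specGen d q), specGen_X_mul_C_stdAddChar]
  rw [Finset.sum_comm]
  simp only [← Finset.mul_sum, ← map_sum, sum_stdAddChar_mul]
  rw [Finset.sum_eq_single s (fun s' _ hs' => by simp [sub_ne_zero.2 hs'.symm]) (by simp),
    sub_self, if_pos rfl, mul_left_comm, ← map_mul, one_div, inv_mul_cancel₀ hd, map_one, mul_one]

/-- The trace on the group algebra of the framed braid group. -/
def preTrace (n : ℕ) : MonoidAlgebra ℂ (FramedBraidGroup d n) →ₗ[ℂ] TraceRing d :=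
  (Finsupp.linearCombination ℂ fun w => specGen d q (genTrace w)) ∘ₗ
    (MonoidAlgebra.coeffLinearEquiv ℂ).toLinearMap

variable {n : ℕ}

theorem preTrace_of (w : FramedBraidGroup d n) :
    preTrace d q n (MonoidAlgebra.of ℂ _ w) = specGen d q (genTrace w) := by
  simp [preTrace]

theorem preTrace_quad (u v : MonoidAlgebra ℂ (FramedBraidGroup d n)) (h : QuadRel d n q u v) :
    contextCon (preTrace d q n) u v := by
  intro a b
  induction a using MonoidAlgebra.induction_on with
  | of w =>
    induction b using MonoidAlgebra.induction_on with
    | of w' =>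
      obtain ⟨i⟩ := h
      rw [sq, mul_add, mul_one, mul_smul_comm, add_mul, smul_mul_assoc, eF, smul_mul_assoc,
        mul_smul_comm, smul_mul_assoc, Finset.sum_mul, Finset.mul_sum, Finset.sum_mul, smul_smul,
        map_add, map_smul, map_sum]
      simp only [← map_mul (MonoidAlgebra.of ℂ _), preTrace_of]
      rw [genTrace_quad, map_add, map_mul, specGen_coeff, map_sum, mul_comm (q - q⁻¹),
        Algebra.smul_def]
    | add x y hx hy => rw [mul_add, mul_add, map_add, map_add, hx, hy]
    | smul c x hx => rw [mul_smul_comm, mul_smul_comm, map_smul, map_smul, hx]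
  | add x y hx hy => simp only [add_mul, map_add, hx, hy]
  | smul c x hx => simp only [smul_mul_assoc, map_smul, hx]

theorem ker_toY_le (n : ℕ) :
    LinearMap.ker (toY d n q).toLinearMap ≤ LinearMap.ker (preTrace d q n) :=
  ker_mkAlgHom_le (preTrace_quad d q)

/-- The weighted trace on the Yokonuma–Hecke algebra, with the generic parameters specialized. -/
def yTrace (n : ℕ) : Y d n q →ₗ[ℂ] TraceRing d :=
  (LinearMap.ker (toY d n q).toLinearMap).liftQ (preTrace d q n)
      (ker_toY_le d q n) ∘ₗ
    ((toY d n q).toLinearMap.quotKerEquivOfSurjective toY_surjective).symm.toLinearMap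

theorem yTrace_framedToY (w : FramedBraidGroup d n) :
    yTrace d q n (framedToY d n q w) = specGen d q (genTrace w) := by
  have h : ((toY d n q).toLinearMap.quotKerEquivOfSurjective toY_surjective).symm
      (framedToY d n q w) = Submodule.Quotient.mk (MonoidAlgebra.of ℂ _ w) := by
    rw [LinearEquiv.symm_apply_eq]; rfl
  rw [yTrace, LinearMap.comp_apply, LinearEquiv.coe_coe, h, Submodule.liftQ_apply, preTrace_of]

theorem yTrace_mul_comm (a b : Y d n q) : yTrace d q n (a * b) = yTrace d q n (b * a) := by
  induction a using Y_induction with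
  | framed w =>
    induction b using Y_induction with
    | framed w' =>
      rw [← map_mul, ← map_mul, yTrace_framedToY, yTrace_framedToY, genTrace_mul_comm]
    | add a b ha hb => rw [mul_add, add_mul, map_add, map_add, ha, hb]
    | smul c a ha => rw [mul_smul_comm, smul_mul_assoc, map_smul, map_smul, ha]
  | add a b ha hb => rw [mul_add, add_mul, map_add, map_add, ha, hb]
  | smul c a ha => rw [mul_smul_comm, smul_mul_assoc, map_smul, map_smul, ha]

theorem yTrace_incl_mul_t_pow (a : Y d n q) (s : ℕ) :
    yTrace d q (n + 1) (incl d n q a * t d q (Fin.last n) ^ s) =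
      xVar d (s : ZMod d) * yTrace d q n a := by
  induction a using Y_induction with
  | framed w =>
    rw [incl_framedToY, t, ← map_pow, ← map_mul, yTrace_framedToY, yTrace_framedToY,
      genTrace_inclF_mul_tF_pow, map_mul, specGen_sum]
  | add a b ha hb => rw [map_add, add_mul, map_add, ha, hb, map_add, mul_add]
  | smul c a ha => rw [map_smul, smul_mul_assoc, map_smul, ha, map_smul, mul_smul_comm]

theorem yTrace_incl (a : Y d n q) : yTrace d q (n + 1) (incl d n q a) = yTrace d q n a := by
  simpa [xVar] using yTrace_incl_mul_t_pow d q a 0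

theorem yTrace_one : ∀ n, yTrace d q n 1 = 1
  | 0 => by rw [← map_one (framedToY d 0 q), yTrace_framedToY, genTrace_zero, map_one]
  | n + 1 => by rw [← map_one (incl d n q), yTrace_incl, yTrace_one n]

theorem yTrace_incl_mul_g (a : Y d (n + 1) q) :
    yTrace d q (n + 2) (incl d (n + 1) q a * g d q (n := n + 2) (Fin.last n)) =
      MvPolynomial.X none * yTrace d q (n + 1) a := by
  induction a using Y_induction with
  | framed w =>
    rw [incl_framedToY, g, ← map_mul, yTrace_framedToY, yTrace_framedToY,
      genTrace_inclF_mul_σF_top, map_mul]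
    simp [specGen]
  | add a b ha hb => rw [map_add, add_mul, map_add, ha, hb, map_add, mul_add]
  | smul c a ha => rw [map_smul, smul_mul_assoc, map_smul, ha, map_smul, mul_smul_comm]

theorem juyumayaTrace_isMarkovTrace :
    IsMarkovTrace d q (MvPolynomial.X none) (xVar d) (juyumayaTrace d q) := by
  have h : ∃ tr : (n : ℕ) → Y d n q →ₗ[ℂ] TraceRing d,
      IsMarkovTrace d q (MvPolynomial.X none) (xVar d) tr :=
    ⟨yTrace d q,
      { compat := fun _ => yTrace_incl d q
        comm := fun _ => yTrace_mul_comm d q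
        one := yTrace_one d q
        markov := fun _ => yTrace_incl_mul_g d q
        framing := fun _ a s _ _ => yTrace_incl_mul_t_pow d q a s }⟩
  rw [juyumayaTrace, dif_pos h]
  exact h.choose_spec

theorem specTrace_isMarkovTrace {x : ZMod d → ℂ} (hx : x 0 = 1) :
    IsMarkovTrace d q Polynomial.X (fun s => algebraMap ℂ (Polynomial ℂ) (x s))
      (specTrace d q x) := by
  convert (juyumayaTrace_isMarkovTrace d q).map (MvPolynomial.aeval fun v =>
    v.elim Polynomial.X fun s => Polynomial.C (x s.1)) using 1
  · simp
  · funext s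
    by_cases hs : s = 0 <;> simp [xVar, hs, hx]
  · rfl

end Existence

/-! ### Colour projections -/

section CharProj

variable {d : ℕ} [NeZero d]

theorem sum_stdAddChar_neg_mul (s : ZMod d) :
    ∑ k : ZMod d, (ZMod.stdAddChar (-(s * k)) : ℂ) = if s = 0 then (d : ℂ) else 0 := by
  simpa only [mul_neg, mul_comm, neg_eq_zero] using sum_stdAddChar_mul (-s)

variable {A B : Type*} [Ring A] [Algebra ℂ A] [Ring B] [Algebra ℂ B]

/-- The projection onto the `χ(k)`-eigenspace of an element `a` with `a ^ d = 1`, where `χ` is the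
standard character of `ℤ/d`. -/
def charProj (k : ZMod d) (a : A) : A :=
  (1 / (d : ℂ)) • ∑ s : ZMod d, (ZMod.stdAddChar (-(s * k)) : ℂ) • a ^ s.val

theorem map_charProj (φ : A →ₐ[ℂ] B) (k : ZMod d) (a : A) :
    φ (charProj k a) = charProj k (φ a) := by
  simp only [charProj, map_smul, map_sum, map_pow]

theorem semiconjBy_charProj {b a a' : A} (h : SemiconjBy b a a') (k : ZMod d) :
    SemiconjBy b (charProj k a) (charProj k a') := by
  simp only [SemiconjBy, charProj, mul_smul_comm, smul_mul_assoc, Finset.mul_sum, Finset.sum_mul,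
    (h.pow_right _).eq]

theorem sum_charProj (a : A) : ∑ k : ZMod d, charProj k a = 1 := by
  have hd : (d : ℂ) ≠ 0 := NeZero.ne _
  simp only [charProj]
  rw [← Finset.smul_sum, Finset.sum_comm]
  simp only [← Finset.sum_smul, sum_stdAddChar_neg_mul, ite_smul, zero_smul, Finset.sum_ite_eq',
    Finset.mem_univ, if_true]
  rw [smul_smul, one_div, inv_mul_cancel₀ hd, one_smul, ZMod.val_zero, pow_zero]

variable {a : A}

theorem mul_charProj (ha : a ^ d = 1) (k : ZMod d) :
    a * charProj k a = (ZMod.stdAddChar k : ℂ) • charProj k a := by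
  have pow_val_succ (s : ZMod d) : a * a ^ s.val = a ^ (s + 1).val := by
    rw [← pow_succ', pow_eq_pow_mod _ ha, ← ZMod.val_natCast, Nat.cast_add, Nat.cast_one,
      ZMod.natCast_zmod_val]
  rw [charProj, mul_smul_comm, smul_comm]
  congr 1
  rw [Finset.mul_sum, Finset.smul_sum,
    ← Equiv.sum_comp (Equiv.addRight (1 : ZMod d)) fun s : ZMod d =>
      (ZMod.stdAddChar k : ℂ) • (ZMod.stdAddChar (-(s * k)) : ℂ) • a ^ s.val]
  refine Finset.sum_congr rfl fun s _ => ?_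
  rw [mul_smul_comm, pow_val_succ, smul_smul, ← AddChar.map_add_eq_mul, Equiv.coe_addRight,
    show k + -((s + 1) * k) = -(s * k) by ring]

theorem pow_mul_charProj (ha : a ^ d = 1) (k : ZMod d) (s : ℕ) :
    a ^ s * charProj k a = (ZMod.stdAddChar k : ℂ) ^ s • charProj k a := by
  induction s with
  | zero => simp
  | succ s ih =>
    rw [pow_succ, mul_assoc, mul_charProj ha, mul_smul_comm, ih, smul_smul, pow_succ']

theorem charProj_mul_self (ha : a ^ d = 1) (k : ZMod d) :
    charProj k a * charProj k a = charProj k a := by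
  have hd : (d : ℂ) ≠ 0 := NeZero.ne _
  have summand_mul (s : ZMod d) :
      (ZMod.stdAddChar (-(s * k)) : ℂ) • a ^ s.val * charProj k a = charProj k a := by
    rw [smul_mul_assoc, pow_mul_charProj ha, smul_smul, ← AddChar.map_nsmul_eq_pow,
      ← AddChar.map_add_eq_mul]
    simp
  conv_lhs => rw [charProj.eq_1 k a, smul_mul_assoc, Finset.sum_mul]
  rw [← charProj, Finset.sum_congr rfl fun s _ => summand_mul s, Finset.sum_const,
    Finset.card_univ, ZMod.card, ← Nat.cast_smul_eq_nsmul ℂ, smul_smul, one_div,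
    inv_mul_cancel₀ hd, one_smul]

end CharProj

theorem semiconjBy_list_prod {M ι : Type*} [Monoid M] {b : M} {u v : ι → M}
    (h : ∀ i, SemiconjBy b (u i) (v i)) (l : List ι) :
    SemiconjBy b (l.map u).prod (l.map v).prod := by
  induction l with
  | nil => exact SemiconjBy.one_right b
  | cons i l ih => simpa only [List.map_cons, List.prod_cons] using (h i).mul_right ih

section Colour

variable {d n : ℕ} {q : ℂ}

theorem t_pow_card (j : Fin n) : t d q j ^ d = 1 := by
  rw [t, ← map_pow, tF_pow, map_one]

theorem t_commute (i j : Fin n) : Commute (t d q i) (t d q j) := by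
  rw [Commute, SemiconjBy, t, t, ← map_mul, ← map_mul, tF_comm]

theorem incl_t (j : Fin n) : incl d n q (t d q j) = t d q j.castSucc := by
  rw [t, incl_framedToY, inclF_tF, t]

theorem semiconjBy_g (i : Fin (n - 1)) (j : Fin n) :
    SemiconjBy (g d q i) (t d q j) (t d q (sTr i j)) := by
  rw [SemiconjBy, t, g, t, ← map_mul, ← map_mul, tF_σF, sTr_sTr]

variable [NeZero d]

variable (q) in
/-- The projection onto the colour `k` of the strand `j`. -/
def colour (k : ZMod d) (j : Fin n) : Y d n q := charProj k (t d q j)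

theorem commute_colour {b : Y d n q} {j : Fin n} (h : Commute b (t d q j)) (k : ZMod d) :
    Commute b (colour q k j) :=
  semiconjBy_charProj h k

theorem colour_commute_t (k : ZMod d) (i j : Fin n) : Commute (colour q k i) (t d q j) :=
  (commute_colour (t_commute j i) k).symm

theorem colour_commute (k : ZMod d) (i j : Fin n) : Commute (colour q k i) (colour q k j) :=
  commute_colour (colour_commute_t k i j) k

theorem colour_mul_self (k : ZMod d) (j : Fin n) :
    colour q k j * colour q k j = colour q k j :=
  charProj_mul_self (t_pow_card j) k

theorem incl_colour (k : ZMod d) (j : Fin n) :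
    incl d n q (colour q k j) = colour q k j.castSucc := by
  rw [colour, map_charProj, incl_t, colour]

variable (q) in
/-- The projection onto the colour `k` of all strands. -/
def allColour (n : ℕ) (k : ZMod d) : Y d n q := (List.ofFn (colour q k)).prod

theorem allColour_succ (k : ZMod d) :
    allColour q (n + 1) k = incl d n q (allColour q n k) * colour q k (Fin.last n) := by
  simp only [allColour, List.ofFn_succ', List.concat_eq_append, List.prod_append,
    List.prod_singleton, map_list_prod, List.map_ofFn, Function.comp_def, incl_colour]

theorem allColour_mul_colour_last (k : ZMod d) :
    allColour q (n + 1) k * colour q k (Fin.last n) = allColour q (n + 1) k := by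
  rw [allColour_succ, mul_assoc, colour_mul_self]

theorem allColour_commute_of_semiconjBy {b : Y d n q} {p : Equiv.Perm (Fin n)}
    (h : ∀ j, SemiconjBy b (t d q j) (t d q (p j))) (k : ZMod d) :
    Commute (allColour q n k) b := by
  have permuted : SemiconjBy b (List.ofFn (colour q k)).prod (List.ofFn (colour q k ∘ p)).prod := by
    rw [List.ofFn_eq_map, List.ofFn_eq_map]
    exact semiconjBy_list_prod (fun j => semiconjBy_charProj (h j) k) (List.finRange n)
  have pairwise_commute : (List.ofFn (colour q k ∘ p)).Pairwise Commute :=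
    List.pairwise_ofFn.2 fun _ _ _ => colour_commute k _ _
  rw [(Equiv.Perm.ofFn_comp_perm p (colour q k)).prod_eq' pairwise_commute] at permuted
  exact Commute.symm permuted

theorem allColour_commute (k : ZMod d) (a : Y d n q) : Commute (allColour q n k) a := by
  induction a using Y_induction with
  | framed w =>
    exact commute_of_generators
      (fun i => allColour_commute_of_semiconjBy (semiconjBy_g i) k)
      (fun i => allColour_commute_of_semiconjBy (p := 1) (t_commute i) k) w
  | add a b ha hb => exact ha.add_right hb
  | smul c a ha => exact ha.smul_right c

end Colour

/-! ### The homomorphisms onto the Hecke algebra -/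

section Hecke

variable {d n : ℕ} {q : ℂ}

theorem algHom_ext_of_generators {B : Type*} [Ring B] [Algebra ℂ B] {φ ψ : Y d n q →ₐ[ℂ] B}
    (hg : ∀ i, φ (g d q i) = ψ (g d q i)) (ht : ∀ j, φ (t d q j) = ψ (t d q j)) : φ = ψ := by
  have framed_eq : (φ : Y d n q →* B).comp (framedToY d n q) = (ψ : Y d n q →* B).comp
      (framedToY d n q) := framedHom_ext hg ht
  ext w
  exact DFunLike.congr_fun framed_eq w

theorem braidToFramed_of (i : Fin (n - 1)) :
    braidToFramed d n (PresentedGroup.of i) = σF d i :=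
  PresentedGroup.toGroup.of _

theorem δ_of (i : Fin (n - 1)) : δ d n q (PresentedGroup.of i) = g d q i :=
  congrArg (framedToY d n q) (braidToFramed_of i)

theorem incl_g (i : Fin (n - 1)) : incl d n q (g d q i) = g d q (up i) := by
  rw [g, incl_framedToY, inclF_σF, g]

theorem hecke_quad (i : Fin (n - 1)) : g 1 q i * g 1 q i = 1 + (q - q⁻¹) • g 1 q i := by
  have tF_eq_one (j : Fin n) : tF 1 j = 1 := by simpa only [pow_one] using tF_pow 1 j
  rw [g, framedToY_quad]
  simp [framingSum, tF_eq_one]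

variable [NeZero d]

theorem stdAddChar_pow_card (k : ZMod d) : (ZMod.stdAddChar k : ℂ) ^ d = 1 := by
  rw [← AddChar.map_nsmul_eq_pow]
  simp

variable (n q)

/-- The action `σ_i ↦ g_i`, `t_j ↦ χ(k)` of the framed braid group by units of the Hecke algebra,
where `χ` is the standard character of `ℤ/d`. -/
def framedToHecke (k : ZMod d) : FramedBraidGroup d n →* (Y 1 n q)ˣ :=
  PresentedGroup.toGroup (f := Sum.elim (fun i => (framedToY 1 n q).toHomUnits (σF 1 i))
    (fun _ => Units.map (algebraMap ℂ (Y 1 n q)).toMonoidHom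
      (Units.ofPowEqOne (ZMod.stdAddChar k) d (stdAddChar_pow_card k) (NeZero.ne d)))) (by
    rintro w (⟨i, j, h⟩ | ⟨i, j, h⟩ | ⟨i, j⟩ | ⟨i, j⟩ | ⟨j⟩) <;>
      simp only [fσ, ft, map_mul, map_inv, map_pow, FreeGroup.lift_apply_of, Sum.elim_inl,
        Sum.elim_inr, mul_inv_eq_one]
    · rw [← map_mul, ← map_mul, ← map_mul, ← map_mul, σF_braid 1 i j h]
    · rw [← map_mul, ← map_mul, σF_comm 1 i j h]
    · exact Units.ext (Algebra.commutes _ _)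
    · rw [← map_pow, Units.pow_ofPowEqOne, map_one])

variable {n q}

theorem framedToHecke_σF (k : ZMod d) (i : Fin (n - 1)) :
    (framedToHecke n q k (σF d i) : Y 1 n q) = g 1 q i :=
  congrArg Units.val (PresentedGroup.toGroup.of _)

theorem framedToHecke_tF (k : ZMod d) (j : Fin n) :
    (framedToHecke n q k (tF d j) : Y 1 n q) = algebraMap ℂ _ (ZMod.stdAddChar k) :=
  congrArg Units.val (PresentedGroup.toGroup.of _)

theorem framedToHecke_tF_pow_mul_inv (k : ZMod d) (i j : Fin n) (s : ℕ) :
    framedToHecke n q k (tF d i ^ s * (tF d j ^ s)⁻¹) = 1 := by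
  have tF_eq : framedToHecke n q k (tF d i) = framedToHecke n q k (tF d j) :=
    Units.ext ((framedToHecke_tF k i).trans (framedToHecke_tF k j).symm)
  rw [map_mul, map_inv, map_pow, map_pow, tF_eq, mul_inv_cancel]

variable (n q) in
/-- The homomorphism `Y_{d,n}(q) → Y_{1,n}(q)`, `g_i ↦ g_i`, `t_j ↦ χ(k)`. -/
def toHecke (k : ZMod d) : Y d n q →ₐ[ℂ] Y 1 n q :=
  RingQuot.liftAlgHom ℂ ⟨MonoidAlgebra.lift ℂ (Y 1 n q) (FramedBraidGroup d n)
    ((Units.coeHom _).comp (framedToHecke n q k)), by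
    rintro _ _ ⟨i⟩
    have hd : (d : ℂ) ≠ 0 := NeZero.ne _
    rw [map_pow, map_add, map_one, map_smul, map_mul, eF, map_smul, map_sum]
    simp only [MonoidAlgebra.lift_of, MonoidHom.comp_apply, framedToHecke_tF_pow_mul_inv,
      Units.coeHom_apply, framedToHecke_σF, Units.val_one, Finset.sum_const, Nat.card_Icc,
      Nat.add_sub_cancel]
    rw [sq, hecke_quad, ← Nat.cast_smul_eq_nsmul ℂ, smul_smul, one_div, inv_mul_cancel₀ hd,
      one_smul, one_mul]⟩

theorem toHecke_framedToY (k : ZMod d) (w : FramedBraidGroup d n) :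
    toHecke n q k (framedToY d n q w) = framedToHecke n q k w := by
  rw [framedToY_apply, toHecke, toY, RingQuot.liftAlgHom_mkAlgHom_apply, MonoidAlgebra.lift_of]
  rfl

theorem toHecke_g (k : ZMod d) (i : Fin (n - 1)) : toHecke n q k (g d q i) = g 1 q i := by
  rw [g, toHecke_framedToY, framedToHecke_σF]

theorem toHecke_t (k : ZMod d) (j : Fin n) :
    toHecke n q k (t d q j) = algebraMap ℂ _ (ZMod.stdAddChar k) := by
  rw [t, toHecke_framedToY, framedToHecke_tF]

theorem toHecke_incl (k : ZMod d) (a : Y d n q) :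
    toHecke (n + 1) q k (incl d n q a) = incl 1 n q (toHecke n q k a) := by
  refine DFunLike.congr_fun (algHom_ext_of_generators
    (φ := (toHecke (n + 1) q k).comp (incl d n q)) (ψ := (incl 1 n q).comp (toHecke n q k))
    (fun i => ?_) (fun j => ?_)) a
  · rw [AlgHom.comp_apply, AlgHom.comp_apply, incl_g, toHecke_g, toHecke_g, incl_g]
  · rw [AlgHom.comp_apply, AlgHom.comp_apply, incl_t, toHecke_t, toHecke_t, AlgHom.commutes]

theorem toHecke_δ (k : ZMod d) (α : BraidGroup n) : toHecke n q k (δ d n q α) = δ 1 n q α :=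
  PresentedGroup.generated_by _
    (((toHecke n q k : Y d n q →* Y 1 n q).comp (δ d n q)).eqLocus (δ 1 n q))
    (fun i => show toHecke n q k (δ d n q (PresentedGroup.of i)) = _ by
      rw [δ_of, toHecke_g, δ_of]) α

end Hecke

/-! ### Solutions of the E-system -/

section ESystem

variable {d : ℕ} [NeZero d]

/-- The Fourier coefficients of `x`. For the solution of the E-system that belongs to the subset
`D` of `ℤ/d` they are `1 / |D|` on `D` and zero elsewhere, up to the choice of the character. -/
def fourier (x : ZMod d → ℂ) (k : ZMod d) : ℂ :=
  1 / (d : ℂ) * ∑ s : ZMod d, x s * ZMod.stdAddChar (-(s * k))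

theorem sum_fourier (x : ZMod d → ℂ) : ∑ k, fourier x k = x 0 := by
  have hd : (d : ℂ) ≠ 0 := NeZero.ne _
  simp only [fourier]
  rw [← Finset.mul_sum, Finset.sum_comm]
  simp only [← Finset.mul_sum, sum_stdAddChar_neg_mul, mul_ite, mul_zero, Finset.sum_ite_eq',
    Finset.mem_univ, if_true]
  field_simp

theorem Esum_eq_sum (x : ZMod d → ℂ) (m : ZMod d) :
    Esum d x m = 1 / (d : ℂ) * ∑ s : ZMod d, x (m + s) * x (-s) := by
  rw [Esum, ← sum_range_natCast fun s : ZMod d => x (m + s) * x (-s)]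
  simp only [CharP.cast_eq_zero, zero_sub]

theorem sum_sum_add_mul_neg {G R : Type*} [AddGroup G] [Fintype G] [NonUnitalNonAssocSemiring R]
    (f : G → R) : ∑ m, ∑ s, f (m + s) * f (-s) = (∑ s, f s) * ∑ s, f s := by
  rw [Finset.sum_comm, Finset.mul_sum, ← Equiv.sum_comp (Equiv.neg G) fun s => (∑ m, f m) * f s]
  refine Finset.sum_congr rfl fun s _ => ?_
  rw [← Finset.sum_mul, ← Equiv.sum_comp (Equiv.addRight s) f]
  rfl

theorem fourier_Esum (x : ZMod d → ℂ) (k : ZMod d) :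
    fourier (Esum d x) k = fourier x k * fourier x k := by
  have term_eq (s m : ZMod d) : x (m + s) * x (-s) * (ZMod.stdAddChar (-(m * k)) : ℂ) =
      x (m + s) * (ZMod.stdAddChar (-((m + s) * k)) : ℂ) *
        (x (-s) * (ZMod.stdAddChar (-(-s * k)) : ℂ)) := by
    rw [mul_mul_mul_comm, ← AddChar.map_add_eq_mul,
      show -((m + s) * k) + -(-s * k) = -(m * k) by ring]
  have convolution := sum_sum_add_mul_neg fun s => x s * (ZMod.stdAddChar (-(s * k)) : ℂ)
  simp only [← term_eq, ← Finset.sum_mul] at convolution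
  simp only [fourier, Esum_eq_sum, mul_assoc (1 / (d : ℂ)), ← Finset.mul_sum]
  rw [convolution]
  ring

variable {x : ZMod d → ℂ}

theorem fourier_mul_self (hx : IsESolution d x) (k : ZMod d) :
    fourier x k * fourier x k = E d x * fourier x k := by
  have Esum_eq (m : ZMod d) : Esum d x m = E d x * x m := by
    rcases eq_or_ne m 0 with rfl | hm
    · rw [hx.zero, mul_one, E]
    · rw [hx.eqn m hm, mul_comm]
  rw [← fourier_Esum, fourier, fourier]
  simp only [Esum_eq, mul_assoc, ← Finset.mul_sum]
  rw [mul_left_comm]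

theorem E_ne_zero (hx : IsESolution d x) : E d x ≠ 0 := by
  intro hE
  have fourier_eq_zero (k : ZMod d) : fourier x k = 0 :=
    mul_self_eq_zero.1 (by rw [fourier_mul_self hx, hE, zero_mul])
  have sum_eq := sum_fourier x
  simp [fourier_eq_zero, hx.zero] at sum_eq

theorem fourier_pow_succ (hx : IsESolution d x) (k : ZMod d) (m : ℕ) :
    fourier x k ^ (m + 1) = E d x ^ m * fourier x k := by
  induction m with
  | zero => simp
  | succ m ih => rw [pow_succ, ih, mul_assoc, fourier_mul_self hx, ← mul_assoc, ← pow_succ]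

theorem sum_fourier_pow (hx : IsESolution d x) (m : ℕ) :
    ∑ k, fourier x k ^ (m + 1) = E d x ^ m := by
  simp only [fourier_pow_succ hx]
  rw [← Finset.mul_sum, sum_fourier, hx.zero, mul_one]

end ESystem

/-! ### The part of the trace of a fixed colour -/

section StdRecursion

variable {R : Type*} [CommRing R] [Algebra ℂ R] {d : ℕ} {q : ℂ}

/-- The values of the linear forms `f n` on the standard elements of `Y_{d,n+1}(q)` reduce to values
on fewer strands, with the factors `c s` and `z`. -/
structure StdRecursion (c : ℕ → R) (z : R) (f : (n : ℕ) → Y d n q →ₗ[ℂ] R) : Prop where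
  framing : ∀ (n : ℕ) (a : Y d n q) (s : ℕ),
    f (n + 1) (incl d n q a * t d q (Fin.last n) ^ s) = c s * f n a
  braiding : ∀ (n : ℕ) (a b : Y d (n + 1) q),
    f (n + 2) (incl d (n + 1) q a * g d q (n := n + 2) (top n) * incl d (n + 1) q b) =
      z * f (n + 1) (b * a)

theorem StdRecursion.unique [NeZero d] {c : ℕ → R} {z : R} {f f' : (n : ℕ) → Y d n q →ₗ[ℂ] R}
    (hf : StdRecursion c z f) (hf' : StdRecursion c z f') (h0 : f 0 1 = f' 0 1) (n : ℕ) :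
    f n = f' n := by
  induction n with
  | zero =>
    ext a
    induction a using Y_induction with
    | framed w => rw [framed_zero_eq_one w, map_one, h0]
    | add a b ha hb => rw [map_add, map_add, ha, hb]
    | smul c a ha => rw [map_smul, map_smul, ha]
  | succ n ih =>
    have std_le : (yTower d q).stdSpan n ≤ LinearMap.eqLocus (f (n + 1)) (f' (n + 1)) := by
      refine Submodule.span_le.2 ?_
      rintro _ (⟨ha, s⟩ | ⟨ha, hb⟩)
      · exact (hf.framing _ _ s).trans ((congrArg _ (by rw [ih])).trans (hf'.framing _ _ s).symm)
      · exact (hf.braiding _ _ _).trans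
          ((congrArg _ (by rw [ih])).trans (hf'.braiding _ _ _).symm)
    refine LinearMap.ext fun a => std_le ((yTower d q).image_le_stdSpan n ?_)
    rw [yTower_image, Algebra.top_toSubmodule]
    exact Submodule.mem_top

end StdRecursion

section MarkovTrace

theorem incl_commute_t_last {d n : ℕ} {q : ℂ} (a : Y d n q) :
    Commute (incl d n q a) (t d q (Fin.last n)) :=
  (yTower d q).commute_ι_t (by rw [yTower_image]; exact Algebra.mem_top)

variable {R : Type} [CommRing R] [Algebra ℂ R] {d n : ℕ} {q : ℂ}

theorem IsMarkovTrace.braiding {z : R} {x : ZMod d → R} {tr : (n : ℕ) → Y d n q →ₗ[ℂ] R}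
    (h : IsMarkovTrace d q z x tr) (a b : Y d (n + 1) q) :
    tr (n + 2) (incl d (n + 1) q a * g d q (n := n + 2) (top n) * incl d (n + 1) q b) =
      z * tr (n + 1) (b * a) := by
  rw [h.comm, ← mul_assoc, ← map_mul, h.markov]

variable [NeZero d] {x : ZMod d → ℂ} {z : R} {tr : (n : ℕ) → Y d n q →ₗ[ℂ] R}

theorem IsMarkovTrace.framing_val
    (h : IsMarkovTrace d q z (fun s => algebraMap ℂ R (x s)) tr) (hx : x 0 = 1) (a : Y d n q)
    (s : ZMod d) : tr (n + 1) (incl d n q a * t d q (Fin.last n) ^ s.val) =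
      algebraMap ℂ R (x s) * tr n a := by
  rcases eq_or_ne s 0 with rfl | hs
  · rw [ZMod.val_zero, pow_zero, mul_one, hx, map_one, one_mul, h.compat]
  · have hs' : 1 ≤ s.val := Nat.one_le_iff_ne_zero.2 ((ZMod.val_ne_zero s).2 hs)
    rw [h.framing n a s.val hs' (ZMod.val_lt s), ZMod.natCast_zmod_val]

theorem IsMarkovTrace.incl_mul_colour
    (h : IsMarkovTrace d q z (fun s => algebraMap ℂ R (x s)) tr) (hx : x 0 = 1) (a : Y d n q)
    (k : ZMod d) : tr (n + 1) (incl d n q a * colour q k (Fin.last n)) =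
      algebraMap ℂ R (fourier x k) * tr n a := by
  rw [colour, charProj, mul_smul_comm, map_smul, Finset.mul_sum, map_sum, fourier, map_mul, map_sum,
    Algebra.smul_def, mul_assoc, Finset.sum_mul]
  congr 1
  refine Finset.sum_congr rfl fun s _ => ?_
  rw [mul_smul_comm, map_smul, h.framing_val hx, Algebra.smul_def, map_mul]
  ring

theorem allColour_mul_incl_mul_t_pow (k : ZMod d) (a : Y d n q) (s : ℕ) :
    allColour q (n + 1) k * (incl d n q a * t d q (Fin.last n) ^ s) =
      (ZMod.stdAddChar k : ℂ) ^ s • (incl d n q (allColour q n k * a) *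
        colour q k (Fin.last n)) := by
  have pow_mul_colour : t d q (Fin.last n) ^ s * colour q k (Fin.last n) =
      (ZMod.stdAddChar k : ℂ) ^ s • colour q k (Fin.last n) :=
    pow_mul_charProj (t_pow_card _) k s
  have colour_comm : Commute (incl d n q a * t d q (Fin.last n) ^ s) (colour q k (Fin.last n)) :=
    (commute_colour (incl_commute_t_last a) k).mul_left
      ((colour_commute_t k _ _).symm.pow_left s)
  rw [allColour_succ, mul_assoc, ← colour_comm.eq, mul_assoc, pow_mul_colour, mul_smul_comm,
    mul_smul_comm, ← mul_assoc, ← map_mul]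

theorem allColour_mul_braiding (k : ZMod d) (a b : Y d (n + 1) q) :
    allColour q (n + 2) k *
        (incl d (n + 1) q a * g d q (n := n + 2) (top n) * incl d (n + 1) q b) =
      incl d (n + 1) q (allColour q (n + 1) k * a) * g d q (n := n + 2) (top n) *
        incl d (n + 1) q (colour q k (Fin.last n) * b) := by
  have incl_comm : Commute (incl d (n + 1) q a) (colour q k (Fin.last (n + 1))) :=
    commute_colour (incl_commute_t_last a) k
  have g_semiconj : SemiconjBy (g d q (n := n + 2) (top n)) (colour q k (Fin.last n).castSucc)
      (colour q k (Fin.last (n + 1))) := by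
    refine semiconjBy_charProj ?_ k
    rw [SemiconjBy, t, g, t, ← map_mul, ← map_mul, tF_last_mul_σF_top]
  calc _ = incl d (n + 1) q (allColour q (n + 1) k) *
        (colour q k (Fin.last (n + 1)) * incl d (n + 1) q a) *
        g d q (n := n + 2) (top n) * incl d (n + 1) q b := by
        rw [allColour_succ]; simp only [mul_assoc]
    _ = incl d (n + 1) q (allColour q (n + 1) k) * incl d (n + 1) q a *
        (colour q k (Fin.last (n + 1)) * g d q (n := n + 2) (top n)) *
        incl d (n + 1) q b := by rw [← incl_comm.eq]; simp only [mul_assoc]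
    _ = _ := by rw [← g_semiconj.eq, map_mul, map_mul, incl_colour]; simp only [mul_assoc]

theorem IsMarkovTrace.stdRecursion_allColour
    (h : IsMarkovTrace d q z (fun s => algebraMap ℂ R (x s)) tr) (hx : x 0 = 1) (k : ZMod d) :
    StdRecursion (fun s => algebraMap ℂ R ((ZMod.stdAddChar k : ℂ) ^ s * fourier x k)) z
      (fun n => tr n ∘ₗ LinearMap.mulLeft ℂ (allColour q n k)) where
  framing n a s := by
    simp only [LinearMap.comp_apply, LinearMap.mulLeft_apply]
    rw [allColour_mul_incl_mul_t_pow, map_smul, h.incl_mul_colour hx, Algebra.smul_def,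
      map_mul (algebraMap ℂ R), mul_assoc]
  braiding n a b := by
    simp only [LinearMap.comp_apply, LinearMap.mulLeft_apply]
    rw [allColour_mul_braiding, h.braiding, ← mul_assoc,
      ← (allColour_commute k (colour q k (Fin.last n) * b)).eq, ← mul_assoc,
      allColour_mul_colour_last, mul_assoc]

theorem IsMarkovTrace.stdRecursion_toHecke {z' : R} {x' : ZMod 1 → R}
    {tr' : (n : ℕ) → Y 1 n q →ₗ[ℂ] R} (h' : IsMarkovTrace 1 q z' x' tr') (k : ZMod d) {c : ℂ}
    (hz : algebraMap ℂ R c * algebraMap ℂ R c * z' = algebraMap ℂ R c * z) :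
    StdRecursion (fun s => algebraMap ℂ R ((ZMod.stdAddChar k : ℂ) ^ s * c)) z
      (fun n => c ^ n • tr' n ∘ₗ (toHecke n q k).toLinearMap) where
  framing n a s := by
    simp only [LinearMap.smul_apply, LinearMap.comp_apply, AlgHom.toLinearMap_apply]
    rw [map_mul (toHecke (n + 1) q k), map_pow (toHecke (n + 1) q k), toHecke_t, toHecke_incl,
      ← map_pow (algebraMap ℂ _), ← Algebra.commutes, ← Algebra.smul_def, map_smul, h'.compat,
      smul_smul, Algebra.smul_def, Algebra.smul_def, ← mul_assoc, ← map_mul]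
    congr 2
    ring
  braiding n a b := by
    simp only [LinearMap.smul_apply, LinearMap.comp_apply, AlgHom.toLinearMap_apply]
    rw [map_mul (toHecke (n + 2) q k), map_mul (toHecke (n + 2) q k), toHecke_incl, toHecke_incl,
      toHecke_g, h'.braiding, map_mul (toHecke (n + 1) q k), Algebra.smul_def, Algebra.smul_def,
      map_pow, map_pow]
    linear_combination algebraMap ℂ R c ^ n *
      tr' (n + 1) (toHecke (n + 1) q k b * toHecke (n + 1) q k a) * hz

theorem IsMarkovTrace.allColour_mul {z' : R} {x' : ZMod 1 → R} {tr' : (n : ℕ) → Y 1 n q →ₗ[ℂ] R}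
    (h : IsMarkovTrace d q (algebraMap ℂ R (E d x) * z') (fun s => algebraMap ℂ R (x s)) tr)
    (hx : IsESolution d x) (h' : IsMarkovTrace 1 q z' x' tr') (k : ZMod d) (a : Y d n q) :
    tr n (allColour q n k * a) = fourier x k ^ n • tr' n (toHecke n q k a) := by
  refine DFunLike.congr_fun ((h.stdRecursion_allColour hx.zero k).unique
    (h'.stdRecursion_toHecke k ?_) ?_ n) a
  · rw [← map_mul, fourier_mul_self hx, map_mul]
    ring
  · simp [allColour, h.one, h'.one]

end MarkovTrace

/-! ### Braids whose closure is a knot -/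

section SingleCycle

variable {ι : Type*} {σ : Equiv.Perm ι}

theorem apply_eq_of_sameCycle [Finite ι] {β : Type*} {f : ι → β} (hf : ∀ i, f (σ i) = f i)
    {i j : ι} (h : σ.SameCycle i j) : f j = f i := by
  obtain ⟨m, rfl⟩ := h.exists_nat_pow_eq
  induction m with
  | zero => rfl
  | succ m ih => rw [pow_succ', Equiv.Perm.mul_apply, hf, ih (σ.sameCycle_pow_right.2 .rfl)]

theorem sign_of_forall_sameCycle [Fintype ι] [DecidableEq ι] [Nonempty ι]
    (h : ∀ i j, σ.SameCycle i j) : Equiv.Perm.sign σ = -(-1) ^ Fintype.card ι := by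
  rcases subsingleton_or_nontrivial ι with _ | _
  · rw [Fintype.card_eq_one_iff.2 ⟨Classical.arbitrary ι, fun _ => Subsingleton.elim _ _⟩, pow_one,
      neg_neg, Subsingleton.elim σ 1, map_one]
  · have no_fixed_point (i : ι) : σ i ≠ i := fun hi =>
      let ⟨j, hj⟩ := exists_ne i
      hj ((h i j).eq_of_left hi).symm
    have support_eq : σ.support = Finset.univ :=
      Finset.eq_univ_of_forall fun i => Equiv.Perm.mem_support.2 (no_fixed_point i)
    have isCycle : σ.IsCycle :=
      ⟨Classical.arbitrary ι, no_fixed_point _, fun j _ => h _ j⟩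
    rw [isCycle.sign, support_eq, Finset.card_univ]

end SingleCycle

section Knot

variable {n : ℕ} {α : BraidGroup n}

theorem sameCycle_of_closureIsKnot (hα : ClosureIsKnot α) (i j : Fin n) :
    (braidPerm n α).SameCycle i j := by
  have := (Nat.card_eq_one_iff_unique.1 hα).1
  have components_eq : (Quotient.mk _ j : ClosureComponent α) = Quotient.mk _ i :=
    Subsingleton.elim _ _
  obtain ⟨⟨_, m, rfl⟩, hm⟩ := MulAction.orbitRel_apply.1 (Quotient.exact components_eq)
  exact ⟨m, hm⟩

theorem pos_of_closureIsKnot (hα : ClosureIsKnot α) : 0 < n := by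
  obtain ⟨c⟩ := (Nat.card_eq_one_iff_unique.1 hα).2
  exact (Quotient.out c).pos

theorem sign_braidPerm (α : BraidGroup n) :
    Equiv.Perm.sign (braidPerm n α) = (-1 : ℤˣ) ^ expSum α := by
  suffices Equiv.Perm.sign.comp (braidPerm n) =
      (zpowersHom ℤˣ (-1 : ℤˣ)).comp (braidExpHom n) from DFunLike.congr_fun this α
  refine PresentedGroup.ext fun i => ?_
  have lo_ne_hi : lo i ≠ hi i := Fin.ne_of_val_ne i.1.succ_ne_self.symm
  rw [MonoidHom.comp_apply, MonoidHom.comp_apply, braidPerm_of, sTr,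
    Equiv.Perm.sign_swap lo_ne_hi, braidExpHom, PresentedGroup.toGroup.of, zpowersHom_apply,
    toAdd_ofAdd, zpow_one]

theorem neg_one_zpow_expSum_of_closureIsKnot {m : ℕ} {α : BraidGroup (m + 1)}
    (hα : ClosureIsKnot α) : (-1 : ℤˣ) ^ expSum α = (-1) ^ m := by
  rw [← sign_braidPerm, sign_of_forall_sameCycle (sameCycle_of_closureIsKnot hα),
    Fintype.card_fin, pow_succ, mul_neg_one, neg_neg]

variable {d : ℕ} {q : ℂ}

theorem semiconjBy_δ (α : BraidGroup n) (j : Fin n) :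
    SemiconjBy (δ d n q α) (t d q j) (t d q (braidPerm n α j)) := by
  let H : Subgroup (BraidGroup n) :=
    { carrier := {α | ∀ j, SemiconjBy (braidToFramed d n α) (tF d j) (tF d (braidPerm n α j))}
      mul_mem' := fun ha hb j => by
        rw [map_mul, map_mul]
        exact (ha _).mul_left (hb j)
      one_mem' := fun j => by
        rw [map_one, map_one]
        exact SemiconjBy.one_left _
      inv_mem' := fun {a} ha j => by
        have h := (ha ((braidPerm n a)⁻¹ j)).inv_symm_left
        rwa [← Equiv.Perm.mul_apply, mul_inv_cancel, Equiv.Perm.one_apply, ← map_inv,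
          ← map_inv] at h }
  have mem_H : α ∈ H := by
    refine PresentedGroup.generated_by _ H (fun i j => ?_) α
    rw [SemiconjBy, braidToFramed_of, braidPerm_of, tF_σF, sTr_sTr]
  exact (mem_H j).map (framedToY d n q)

variable [NeZero d] {S : Type*} {τ : Y d n q → S}

theorem trace_mul_colour_eq_of_closureIsKnot (hτ : ∀ a b, τ (a * b) = τ (b * a))
    (hα : ClosureIsKnot α) (k : ZMod d) {b : Y d n q} (hb : ∀ j, Commute b (t d q j))
    (i j : Fin n) : τ (b * colour q k i * δ d n q α) = τ (b * colour q k j * δ d n q α) := by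
  refine apply_eq_of_sameCycle (f := fun i => τ (b * colour q k i * δ d n q α)) (fun i => ?_)
    (sameCycle_of_closureIsKnot hα j i)
  -- Moving `δ α` once around the trace moves the colour along the permutation of `α`.
  rw [mul_assoc, colour, ← (semiconjBy_charProj (semiconjBy_δ α i) k).eq, ← colour, ← mul_assoc,
    hτ, ← mul_assoc, (commute_colour (hb i) k).eq]

theorem trace_colour_mul_prod_of_closureIsKnot (hτ : ∀ a b, τ (a * b) = τ (b * a))
    (hα : ClosureIsKnot α) (k : ZMod d) (i : Fin n) (l : List (Fin n)) :
    τ (colour q k i * (l.map (colour q k)).prod * δ d n q α) = τ (colour q k i * δ d n q α) := by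
  induction l with
  | nil => rw [List.map_nil, List.prod_nil, mul_one]
  | cons j l ih =>
    have prod_commute (p : Fin n) : Commute (l.map (colour q k)).prod (t d q p) :=
      Commute.list_prod_left _ _ fun _ h => by
        obtain ⟨j', _, rfl⟩ := List.mem_map.1 h
        exact colour_commute_t k j' p
    calc
      _ = τ (colour q k i * (l.map (colour q k)).prod * colour q k j * δ d n q α) := by
        rw [List.map_cons, List.prod_cons, ← (commute_colour (prod_commute j) k).eq, ← mul_assoc]
      _ = τ (colour q k i * (l.map (colour q k)).prod * colour q k i * δ d n q α) :=
        trace_mul_colour_eq_of_closureIsKnot hτ hα k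
          (fun p => (colour_commute_t k i p).mul_left (prod_commute p)) j i
      _ = τ (colour q k i * (l.map (colour q k)).prod * δ d n q α) := by
        rw [mul_assoc (colour q k i), (commute_colour (prod_commute i) k).eq, ← mul_assoc,
          colour_mul_self]
      _ = _ := ih

theorem trace_allColour_of_closureIsKnot {m : ℕ} {α : BraidGroup (m + 1)}
    {τ : Y d (m + 1) q → S} (hτ : ∀ a b, τ (a * b) = τ (b * a)) (hα : ClosureIsKnot α)
    (k : ZMod d) : τ (allColour q (m + 1) k * δ d (m + 1) q α) =
      τ (colour q k (Fin.last m) * δ d (m + 1) q α) := by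
  rw [← allColour_mul_colour_last, (allColour_commute k _).eq, allColour, List.ofFn_eq_map,
    trace_colour_mul_prod_of_closureIsKnot hτ hα]

theorem IsMarkovTrace.eq_of_closureIsKnot {R : Type} [CommRing R] [Algebra ℂ R] {x : ZMod d → ℂ}
    {z : R} {x' : ZMod 1 → R} {tr : (n : ℕ) → Y d n q →ₗ[ℂ] R}
    {tr' : (n : ℕ) → Y 1 n q →ₗ[ℂ] R}
    (h : IsMarkovTrace d q (algebraMap ℂ R (E d x) * z) (fun s => algebraMap ℂ R (x s)) tr)
    (hx : IsESolution d x) (h' : IsMarkovTrace 1 q z x' tr') {m : ℕ} {α : BraidGroup (m + 1)}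
    (hα : ClosureIsKnot α) :
    tr (m + 1) (δ d (m + 1) q α) = E d x ^ m • tr' (m + 1) (δ 1 (m + 1) q α) :=
  calc
    _ = ∑ k, tr (m + 1) (colour q k (Fin.last m) * δ d (m + 1) q α) := by
      rw [← map_sum, ← Finset.sum_mul]
      unfold colour
      rw [sum_charProj, one_mul]
    _ = ∑ k, fourier x k ^ (m + 1) • tr' (m + 1) (δ 1 (m + 1) q α) := by
      refine Finset.sum_congr rfl fun k _ => ?_
      rw [← trace_allColour_of_closureIsKnot (h.comm _) hα, h.allColour_mul hx h', toHecke_δ]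
    _ = _ := by rw [← Finset.sum_smul, sum_fourier_pow hx]

end Knot

section Theta

variable {d : ℕ} [NeZero d] {q : ℂ} {x : ZMod d → ℂ}

theorem specTrace_of_closureIsKnot (hx : IsESolution d x) {m : ℕ} {α : BraidGroup (m + 1)}
    (hα : ClosureIsKnot α) :
    specTrace d q x (m + 1) (δ d (m + 1) q α) = E d x ^ m • Polynomial.aeval
      (Polynomial.C (E d x)⁻¹ * Polynomial.X)
      (specTrace 1 q (fun _ => 1) (m + 1) (δ 1 (m + 1) q α)) := by
  have h := specTrace_isMarkovTrace d q hx.zero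
  have h' := (specTrace_isMarkovTrace 1 q (x := fun _ => 1) rfl).map
    (Polynomial.aeval (Polynomial.C (E d x)⁻¹ * Polynomial.X : Polynomial ℂ))
  rw [Polynomial.aeval_X] at h'
  have scale_X : Polynomial.X = algebraMap ℂ (Polynomial ℂ) (E d x) *
      (Polynomial.C (E d x)⁻¹ * Polynomial.X) := by
    rw [Polynomial.algebraMap_eq, ← mul_assoc, ← Polynomial.C_mul,
      mul_inv_cancel₀ (E_ne_zero hx), Polynomial.C_1, one_mul]
  rw [scale_X] at h
  exact h.eq_of_closureIsKnot hx h' hα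

variable {K : Type*} [Field K]

theorem inv_pow_mul_zpow_eq_of_sq_eq_sq {r r' : K} (h : r' ^ 2 = r ^ 2) {m : ℕ} {e : ℤ}
    (he : (-1 : ℤˣ) ^ e = (-1) ^ m) : r'⁻¹ ^ m * r' ^ e = r⁻¹ ^ m * r ^ e := by
  rcases sq_eq_sq_iff_eq_or_eq_neg.1 h with rfl | rfl
  · rfl
  have sign_cast : (-1 : K) ^ e = (-1) ^ m := by
    simpa [Units.ext_iff] using congrArg (Units.map (Int.castRingHom K : ℤ →* K)) he
  rw [inv_neg, neg_pow r⁻¹, ← neg_one_mul r, mul_zpow, sign_cast, mul_mul_mul_comm, ← mul_pow,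
    neg_one_mul, neg_neg, one_pow, one_mul]

variable [Algebra ℂ K]

theorem Theta_eq_Homflypt (hx : IsESolution d x) {n : ℕ} {α : BraidGroup n}
    (hα : ClosureIsKnot α) {z r r' : K} (hr : r' ^ 2 = r ^ 2) :
    Theta d q x z r α = Homflypt q (z / algebraMap ℂ K (E d x)) r' α := by
  obtain ⟨m, rfl⟩ := Nat.exists_eq_add_one.2 (pos_of_closureIsKnot hα)
  have trace_eq : Polynomial.aeval z (specTrace d q x (m + 1) (δ d (m + 1) q α)) =
      algebraMap ℂ K (E d x) ^ m * Polynomial.aeval (z / algebraMap ℂ K (E d x))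
        (specTrace 1 q (fun _ => 1) (m + 1) (δ 1 (m + 1) q α)) := by
    rw [specTrace_of_closureIsKnot hx hα, map_smul, Algebra.smul_def, map_pow,
      ← Polynomial.aeval_algHom_apply, map_mul, Polynomial.aeval_C, Polynomial.aeval_X, map_inv₀,
      div_eq_inv_mul]
  have normalization_eq := inv_pow_mul_zpow_eq_of_sq_eq_sq hr
    (neg_one_zpow_expSum_of_closureIsKnot hα)
  rw [Homflypt, Theta, Theta, trace_eq, Nat.cast_succ, add_sub_cancel_right, zpow_natCast,
    zpow_natCast, one_div, one_div, mul_inv, mul_inv, inv_div, div_eq_mul_inv _ z, mul_pow, mul_pow,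
    mul_pow]
  linear_combination -(z⁻¹ ^ m * algebraMap ℂ K (E d x) ^ m * Polynomial.aeval
    (z / algebraMap ℂ K (E d x)) (specTrace 1 q (fun _ => 1) (m + 1) (δ 1 (m + 1) q α))) *
      normalization_eq

end Theta

end YH

end

theorem mainTheorem1 {K : Type*} [Field K] [Algebra ℂ K] (d : ℕ) [NeZero d] (q : ℂ) (hq : q ≠ 0)
    (x : ZMod d → ℂ) (hx : YH.IsESolution d x) (n : ℕ) (α : YH.BraidGroup n)
    (hα : YH.ClosureIsKnot α) :
    (∀ z r r' : K, z ≠ 0 → YH.lam q (YH.E d x) z ≠ 0 →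
      r ^ 2 = YH.lam q (YH.E d x) z →
      r' ^ 2 = YH.lam q 1 (z / algebraMap ℂ K (YH.E d x)) →
      YH.Theta d q x z r α = YH.Homflypt q (z / algebraMap ℂ K (YH.E d x)) r' α) ∧
    (∀ l r r' : K, q ^ 2 ≠ 1 → l ≠ 0 → l ≠ 1 → r ^ 2 = l → r' ^ 2 = l →
      YH.Theta d q x (algebraMap ℂ K ((q - q⁻¹) * YH.E d x) / (1 - l)) r α =
        YH.Homflypt q (algebraMap ℂ K (q - q⁻¹) / (1 - l)) r' α) := by
  have hE : algebraMap ℂ K (YH.E d x) ≠ 0 := by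
    rw [Ne, FaithfulSMul.algebraMap_eq_zero_iff]; exact YH.E_ne_zero hx
  refine ⟨fun z r r' hz _ hr hr' => YH.Theta_eq_Homflypt hx hα ?_,
    fun l r r' _ _ _ hr hr' => ?_⟩
  · rw [hr, hr', YH.lam, YH.lam, mul_one, map_mul]
    field_simp
  · rw [YH.Theta_eq_Homflypt hx hα (hr'.trans hr.symm), map_mul]
    congr 1
    field_simp
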